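/- Let $\mathbb D$ be $\mathbb R$, $\mathbb C$ or the quaternions $\mathbb H$, and let $\mathsf H$ be a Hilbert space over $\mathbb D$, not necessarily separable. For $\mathbb D=\mathbb H$ this means a complete right $\mathbb H$-vector space with a Hermitian scalar product $\langle x|y\rangle\in\mathbb H$ satisfying $\langle x|yq\rangle=\langle x|y\rangle q$ and $\|x\|^2=\langle x|x\rangle$; in all cases $\langle\cdot|\cdot\rangle$ is linear in the second entry. Let $\mathfrak B(\mathsf H)$ be the set of bounded $\mathbb D$-linear operators on $\mathsf H$ and $A^*$ the adjoint of $A$. Write $A\ge 0$ if $\langle x|Ax\rangle$ is real and $\ge 0$ for all $x\in\mathsf H$, and $A\ge B$ if $A-B\ge 0$. Let $|T|=\sqrt{T^*T}$ be the unique self-adjoint positive operator with $|T|^2=T^*T$. A Hilbert basis of a closed subspace is a maximal orthonormal subset of it. An operator $T\in\mathfrak B(\mathsf H)$ is of trace class, $T\in\mathfrak B_1(\mathsf H)$, if $\sum_{u\in N}\langle u|\,|T|u\rangle<+\infty$ for some Hilbert basis $N$ of $\mathsf H$, and then $\|T\|_1:=\sum_s s\,d_s$, where $s$ runs over the eigenvalues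 of $|T|$ and $d_s$ is the dimension of the $s$-eigenspace (with $0\cdot\infty=0$). Let $N\subset\mathsf H$ be a Hilbert basis and $T\in\mathfrak B_1(\mathsf H)$. In the sum $$tr_N(T):=\sum_{x\in N}\langle x|Tx\rangle$$ at most countably many terms are non-zero, the sum converges absolutely (hence can be re-ordered arbitrarily), and $|tr_N(T)|\le\|T\|_1<+\infty$. Moreover: (a) For $A,B\in\mathfrak B_1(\mathsf H)$ and $a,b\in\mathbb R$ (or $a,b\in\mathbb C$ if $\mathbb D=\mathbb C$): (i) $tr_N(A^*)=\overline{tr_N(A)}$; (ii) $tr_N(aA+bB)=a\,tr_N(A)+b\,tr_N(B)$; (iii) $tr_N(A)\ge 0$ whenever $A\ge 0$. (b) If $\mathbb D=\mathbb R$ or $\mathbb C$, $A\in\mathfrak B_1(\mathsf H)$ and $B\in\mathfrak B(\mathsf H)$, then (i) $tr_N(A)=tr_{N'}(A)$ for all Hilbert bases $N,N'$ of $\mathsf H$; (ii) $tr_N(AB)=tr_N(BA)$. (c) If $\mathbb D=\mathbb H$ and $A\in\mathfrak B_1(\mathsf H)$, then $tr_N(A)=tr_{N'}(A)$ for all Hilbert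 bases $N,N'$ of $\mathsf H$ if and only if $A=A^*$. (d) If $A\in\mathfrak B_1(\mathsf H)$ and $B\in\mathfrak B(\mathsf H)$, then (i) $\mathrm{Re}(tr_N(A))=\mathrm{Re}(tr_{N'}(A))$ for all Hilbert bases $N,N'$ of $\mathsf H$; (ii) the sums defining $tr_N(AB)$ and $tr_N(BA)$ converge absolutely and $\mathrm{Re}(tr_N(AB))=\mathrm{Re}(tr_N(BA))$. (e) If $A=A^*\in\mathfrak B_1(\mathsf H)$ and $N_A$ is the union of a Hilbert basis of $\mathrm{Ker}(A)$ and a Hilbert basis of $\mathrm{Ker}(A)^\perp$ made of eigenvectors of $A$, then $tr_{N_A}(BA)=tr_{N_A}(AB)$ for every $B\in\mathfrak B_1(\mathsf H)$. If furthermore $B=B^*$, then $tr_{N_A}(AB)\in\mathbb R$. (f) If $A,B\in\mathfrak B_1(\mathsf H)$ satisfy $A\ge B$, then $\mathrm{Re}(tr_N(A))\ge\mathrm{Re}(tr_N(B))$ for every Hilbert basis $N$ of $\mathsf H$. -/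

import Mathlib

open scoped Quaternion

noncomputable section

/-! ### Quaternionic Hilbert spaces

Scalars act on the right: `H` is a module over `ℍᵐᵒᵖ`, and `MulOpposite.op q • x` is the vector
`x q`. -/

/-- A right vector space over the quaternions with a scalar product `⟨x|y⟩ = inner ℍ[ℝ] x y` that
is Hermitian, right linear in the second entry, and induces the norm: `⟨x|x⟩ = ‖x‖²`.
Together with `[CompleteSpace H]` this is a quaternionic Hilbert space. -/
class QuaternionicInnerProductSpace (H : Type*) [NormedAddCommGroup H] extends
    Module ℍ[ℝ]ᵐᵒᵖ H, Inner ℍ[ℝ] H where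
  conj_inner_symm : ∀ x y : H, star (inner y x) = inner x y
  inner_add_right : ∀ x y z : H, inner x (y + z) = inner x y + inner x z
  inner_smul_right : ∀ (x y : H) (q : ℍ[ℝ]), inner x (MulOpposite.op q • y) = inner x y * q
  inner_self_eq : ∀ x : H, inner x x = ((‖x‖ ^ 2 : ℝ) : ℍ[ℝ])

namespace QuaternionicInnerProductSpace

variable {H : Type*} [NormedAddCommGroup H] [QuaternionicInnerProductSpace H]

theorem inner_add_left (x y z : H) :
    inner ℍ[ℝ] (x + y) z = inner ℍ[ℝ] x z + inner ℍ[ℝ] y z := by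
  rw [← conj_inner_symm, inner_add_right, star_add, conj_inner_symm, conj_inner_symm]

theorem inner_smul_left (x y : H) (q : ℍ[ℝ]) :
    inner ℍ[ℝ] (MulOpposite.op q • x) y = star q * inner ℍ[ℝ] x y := by
  rw [← conj_inner_symm, inner_smul_right, star_mul, conj_inner_symm]

/-- The underlying real vector space: `r x := x r` for real `r`. -/
instance instModuleReal : Module ℝ H := Module.compHom H (algebraMap ℝ ℍ[ℝ]ᵐᵒᵖ)

theorem real_smul_def (r : ℝ) (x : H) : r • x = MulOpposite.op (r : ℍ[ℝ]) • x := rfl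

instance instIsScalarTowerReal : IsScalarTower ℝ ℍ[ℝ]ᵐᵒᵖ H where
  smul_assoc r q x := by
    rw [Algebra.smul_def, mul_smul]
    rfl

instance instSMulCommClassReal : SMulCommClass ℍ[ℝ]ᵐᵒᵖ ℝ H where
  smul_comm q r x := by
    change q • (algebraMap ℝ ℍ[ℝ]ᵐᵒᵖ r • x) = algebraMap ℝ ℍ[ℝ]ᵐᵒᵖ r • (q • x)
    rw [← mul_smul, ← mul_smul, Algebra.commutes]

/-- The underlying real Hilbert space, with real scalar product `(x|y) = Re ⟨x|y⟩` and the same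
norm. -/
instance instInnerProductSpaceReal : InnerProductSpace ℝ H where
  norm_smul_le r x := by
    have h := inner_self_eq (r • x)
    rw [real_smul_def, inner_smul_left, inner_smul_right, inner_self_eq, Quaternion.star_coe,
      ← Quaternion.coe_mul, ← Quaternion.coe_mul, Quaternion.coe_inj, ← real_smul_def] at h
    have h2 : ‖r • x‖ ^ 2 = (‖r‖ * ‖x‖) ^ 2 := by
      rw [← h, mul_pow, Real.norm_eq_abs, sq_abs]; ring
    exact ((sq_eq_sq₀ (norm_nonneg _) (by positivity)).1 h2).le
  inner x y := (inner ℍ[ℝ] x y).re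
  norm_sq_eq_re_inner x := by
    rw [inner_self_eq]
    simp only [Quaternion.re_coe, RCLike.re_to_real]
  conj_inner_symm x y := by
    rw [← conj_inner_symm x y]
    simp
  add_left x y z := by
    rw [inner_add_left]
    simp
  smul_left x y r := by
    rw [real_smul_def, inner_smul_left]
    simp

theorem real_inner_def (x y : H) : inner ℝ x y = (inner ℍ[ℝ] x y).re := rfl

theorem re_mul_comm (p q : ℍ[ℝ]) : (p * q).re = (q * p).re := by
  simp [Quaternion.re_mul]
  ring

theorem real_inner_smul_right (x y : H) (q : ℍ[ℝ]) :
    inner ℝ x (MulOpposite.op q • y) = inner ℝ (MulOpposite.op (star q) • x) y := by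
  rw [real_inner_def, real_inner_def, inner_smul_right, inner_smul_left, star_star, re_mul_comm]

variable [CompleteSpace H]

/-- The adjoint of a bounded quaternionic linear operator: the adjoint with respect to the
underlying real Hilbert space, which is again quaternionic linear. It is the adjoint for the
quaternionic scalar product by `adjoint_inner_left`. -/
def adjoint (A : H →L[ℍ[ℝ]ᵐᵒᵖ] H) : H →L[ℍ[ℝ]ᵐᵒᵖ] H where
  toFun := ContinuousLinearMap.adjoint (A.restrictScalars ℝ)
  map_add' x y := map_add _ x y
  map_smul' q x := by
    induction q using MulOpposite.rec' with
    | _ q =>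
    refine ext_inner_left ℝ fun v => ?_
    rw [ContinuousLinearMap.adjoint_inner_right, RingHom.id_apply, real_inner_smul_right,
      real_inner_smul_right, ContinuousLinearMap.adjoint_inner_right]
    simp
  cont := (ContinuousLinearMap.adjoint (A.restrictScalars ℝ)).continuous

theorem adjoint_inner_left (A : H →L[ℍ[ℝ]ᵐᵒᵖ] H) (x y : H) :
    inner ℍ[ℝ] (adjoint A x) y = inner ℍ[ℝ] x (A y) := by
  have key : ∀ q : ℍ[ℝ], (inner ℍ[ℝ] (adjoint A x) y * q).re = (inner ℍ[ℝ] x (A y) * q).re := by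
    intro q
    rw [← inner_smul_right, ← inner_smul_right, ← map_smul, ← real_inner_def, ← real_inner_def]
    exact ContinuousLinearMap.adjoint_inner_left (A.restrictScalars ℝ) _ _
  have h := key (star (inner ℍ[ℝ] (adjoint A x) y - inner ℍ[ℝ] x (A y)))
  rw [← sub_eq_zero, ← Quaternion.re_sub, ← sub_mul, ← Quaternion.normSq_def,
    Quaternion.normSq_eq_zero] at h
  exact sub_eq_zero.1 h

/-- `star A` is the Hermitian adjoint `A*`. -/
instance instStarOperator : Star (H →L[ℍ[ℝ]ᵐᵒᵖ] H) := ⟨adjoint⟩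

end QuaternionicInnerProductSpace

/-! ### Notions common to real, complex and quaternionic Hilbert spaces

`D` is the set of values of the scalar product (`ℝ`, `ℂ` or `ℍ`), and `R` is the ring of scalars
acting on `H`: `R = D` in the real and complex cases and `R = Dᵐᵒᵖ` in the quaternionic case.
Bounded operators are continuous `R`-linear maps; `S * T` is the composition and `star T` the
Hermitian adjoint. -/

namespace TraceClass

section

variable (D : Type*) [NormedRing D] [NormedAlgebra ℝ D] {R : Type*} [Ring R] [Algebra ℝ R]
  {H : Type*} [NormedAddCommGroup H] [Module R H] [Inner D H]

/-- `z` is a non-negative real number. -/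
def IsNonnegReal (z : D) : Prop := ∃ r : ℝ, 0 ≤ r ∧ z = algebraMap ℝ D r

/-- `T ≥ 0`: `⟨u|Tu⟩ ≥ 0` for all `u` (no self-adjointness is required). -/
def IsPositive (T : H →L[R] H) : Prop := ∀ u : H, IsNonnegReal D (inner D u (T u))

/-- `N` is a Hilbert basis of the set `V` (a closed subspace of `H`): a maximal orthonormal
subset. -/
structure IsHilbertBasisOf (V N : Set H) : Prop where
  subset : N ⊆ V
  inner_self : ∀ u ∈ N, inner D u u = 1
  inner_ne : ∀ u ∈ N, ∀ v ∈ N, u ≠ v → inner D u v = 0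
  total : ∀ x ∈ V, (∀ u ∈ N, inner D u x = 0) → x = 0

/-- `N` is a Hilbert basis of `H`. -/
def IsHilbertBasis (N : Set H) : Prop := IsHilbertBasisOf D Set.univ N

/-- `Ker(T)`. -/
def kernel (T : H →L[R] H) : Set H := {x | T x = 0}

/-- The orthogonal complement of a set. -/
def perp (V : Set H) : Set H := {x | ∀ y ∈ V, inner D y x = 0}

/-- `u` is an eigenvector of `T`: `u ≠ 0` and `T u = u q` for some scalar `q`. -/
def IsEigenvector (T : H →L[R] H) (u : H) : Prop := u ≠ 0 ∧ ∃ q : R, T u = q • u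

/-- The eigenspace of `T` for a real number `s`. -/
def eigenspace (T : H →L[R] H) (s : ℝ) : Submodule R H where
  carrier := {u | T u = algebraMap ℝ R s • u}
  add_mem' {u v} hu hv := by
    simp only [Set.mem_ofPred_eq] at hu hv ⊢
    rw [map_add, hu, hv, smul_add]
  zero_mem' := by simp
  smul_mem' q u hu := by
    simp only [Set.mem_ofPred_eq] at hu ⊢
    rw [map_smul, hu, ← mul_smul, ← mul_smul, Algebra.commutes]

/-- The set of real eigenvalues of `T`. For self-adjoint `T` this is the (spherical, if `D = ℍ`)
point spectrum of `T`, all eigenvalues being real. -/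
def realPointSpectrum (T : H →L[R] H) : Set ℝ := {s | eigenspace T s ≠ ⊥}

/-- The dimension of the eigenspace of `T` for a real number `s`, possibly `∞`. -/
def eigenDim (T : H →L[R] H) (s : ℝ) : ℕ∞ := Cardinal.toENat (Module.rank R (eigenspace T s))

/-- The `N`-trace `tr_N(T) = ∑_{x ∈ N} ⟨x|Tx⟩`. -/
def traceOn (N : Set H) (T : H →L[R] H) : D := ∑' x : N, inner D (x : H) (T x)

variable [Star (H →L[R] H)]

/-- `S` is the absolute value of `T`, the positive self-adjoint square root of `T*T`
(it always exists and is unique). -/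
structure IsAbs (T S : H →L[R] H) : Prop where
  selfAdjoint : star S = S
  positive : IsPositive D S
  mul_self : S * S = star T * T

/-- The absolute value `|T| = √(T*T)`. -/
def absOp (T : H →L[R] H) : H →L[R] H := Classical.epsilon fun S => IsAbs D T S

/-- `T` is of trace class: `∑_{u ∈ N} ⟨u| |T| u⟩ < ∞` for some Hilbert basis `N`. -/
def IsTraceClass (T : H →L[R] H) : Prop :=
  ∃ S : H →L[R] H, IsAbs D T S ∧
    ∃ N : Set H, IsHilbertBasis D N ∧ Summable fun u : N => inner D (u : H) (S u)

/-- The trace norm `‖T‖₁`: the sum of the eigenvalues `s` of `|T|`, each counted as many times as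
the dimension of its eigenspace (with `0 · ∞ = 0` for the eigenvalue `0`). -/
def traceNorm (T : H →L[R] H) : ENNReal :=
  ∑' s : realPointSpectrum (absOp D T),
    ENNReal.ofReal (s : ℝ) * (eigenDim (absOp D T) (s : ℝ) : ENNReal)

end

end TraceClass

end

open TraceClass Filter Topology

/-!
The three cases `D = ℝ, ℂ, ℍ` are treated at once: `ScalarHilbertSpace D R H` records a `D`-valued
scalar product together with the underlying real Hilbert space, and the only facts about `D` that
matter are that it is finite-dimensional over `ℝ`, that `q* q = ‖q‖²`, and that the real part is
tracial, `Re (pq) = Re (qp)`.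

The argument rests on nuclear series `T x = ∑ᵢ aᵢ ⟨bᵢ|x⟩` with `∑ᵢ ‖aᵢ‖ ‖bᵢ‖ < ∞`
(`HasNuclearSeries`). For such `T`, Bessel's inequality gives
`∑_{u ∈ N} |⟨u|Tu⟩| ≤ ∑ᵢ ‖aᵢ‖ ‖bᵢ‖`, and exchanging the summations in
`∑_u ∑ᵢ φ(⟨u|aᵢ⟩⟨bᵢ|u⟩)` gives `φ (tr_N T) = ∑ᵢ φ ⟨bᵢ|aᵢ⟩` for every real-linear `φ` with
`φ (pq) = φ (qp)` (`HasNuclearSeries.map_traceOn`). The right-hand side does not mention `N`, and it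
is the same for `AB` and `BA`, whose series are `(aᵢ, B* bᵢ)` and `(B aᵢ, bᵢ)`. Taking `φ = id` if
`D` is commutative and `φ = Re` in general yields basis independence and cyclicity.

A trace class operator has a nuclear series with `∑ ‖aᵢ‖ ‖bᵢ‖ = ‖T‖₁`
(`IsTraceClass.exists_hasNuclearSeries`). Indeed `S = |T|` satisfies `‖S u‖² ≤ ‖S‖ ⟨u|Su⟩`, so it is
Hilbert–Schmidt, hence compact on the underlying real Hilbert space, and the real spectral theorem
provides a Hilbert basis of `H` made of eigenvectors `e` of `S`. Then `T x = ∑ (T e) ⟨e|x⟩` with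
`‖T e‖ = ‖S e‖`, the eigenvalue at `e`. The eigenbasis also shows that the absolute value is unique
(`HasSummableDiagonal.eq_of_mul_self_eq`), so that `‖T‖₁` may be computed from `S`.

Over `ℍ`, a self-adjoint operator has real `⟨u|Au⟩`, so its trace is its own real part and does not
depend on `N`. Conversely, replacing one basis vector `u` by `u q` shows that an `N`-independent
trace forces `⟨u|Au⟩` to commute with all unit quaternions, hence to be real, and polarization gives
`A = A*` (`QuaternionicInnerProductSpace.star_eq_of_traceOn_eq`).
-/

set_option linter.unusedSectionVars false

noncomputable section

/-! ### Hilbert spaces over `ℝ`, `ℂ` and `ℍ`, uniformly -/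

/-- What the proof uses of the values `D = ℝ, ℂ, ℍ` of a scalar product: finite dimension over `ℝ`,
a real part that is tracial, and `q* q = ‖q‖²`. -/
class HilbertScalars (D : Type*) [NormedRing D] [NormedAlgebra ℝ D] [StarRing D] where
  finiteDimensional : FiniteDimensional ℝ D
  re : D →ₗ[ℝ] ℝ
  re_algebraMap : ∀ r : ℝ, re (algebraMap ℝ D r) = r
  re_mul_comm : ∀ p q : D, re (p * q) = re (q * p)
  star_mul_self : ∀ q : D, star q * q = algebraMap ℝ D (‖q‖ ^ 2)

/-- A `D`-valued scalar product, with the underlying real Hilbert space. -/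
class ScalarInnerSpace (D H : Type*) [NormedRing D] [NormedAlgebra ℝ D] [StarRing D]
    [HilbertScalars D] [NormedAddCommGroup H] [InnerProductSpace ℝ H] [Inner D H] : Prop where
  inner_add_right : ∀ x y z : H, inner D x (y + z) = inner D x y + inner D x z
  star_inner : ∀ x y : H, star (inner D y x) = inner D x y
  inner_self : ∀ x : H, inner D x x = algebraMap ℝ D (‖x‖ ^ 2)
  re_inner : ∀ x y : H, HilbertScalars.re (inner D x y) = inner ℝ x y

/-- The scalar product is compatible with the action of the ring of scalars `R` and with the given
`star` on operators, which is the adjoint. The identification `toScalar` is the identity for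
`D = ℝ, ℂ` and `MulOpposite.op` for `D = ℍ`, so that `toScalar q • x` is always the vector `x q`. -/
class ScalarHilbertSpace (D R H : Type*) [NormedRing D] [NormedAlgebra ℝ D] [StarRing D]
    [HilbertScalars D] [Ring R] [Algebra ℝ R] [NormedAddCommGroup H] [InnerProductSpace ℝ H]
    [Module R H] [Inner D H] [Star (H →L[R] H)] extends ScalarInnerSpace D H where
  toScalar : D ≃ₗ[ℝ] R
  inner_smul_right : ∀ (x y : H) (q : D), inner D x (toScalar q • y) = inner D x y * q
  inner_star_left : ∀ (A : H →L[R] H) (x y : H), inner D (star A x) y = inner D x (A y)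

namespace HilbertScalars

attribute [instance] finiteDimensional

variable {D : Type*} [NormedRing D] [NormedAlgebra ℝ D] [StarRing D] [HilbertScalars D]

theorem norm_sq_eq (q : D) : ‖q‖ ^ 2 = re (star q * q) := by
  rw [star_mul_self, re_algebraMap]

theorem algebraMap_injective : Function.Injective (algebraMap ℝ D) := fun r s h => by
  rw [← re_algebraMap (D := D) r, h, re_algebraMap]

theorem re_one : re (1 : D) = 1 := by
  rw [← map_one (algebraMap ℝ D), re_algebraMap]

instance : NormOneClass D where
  norm_one := by
    have h := norm_sq_eq (1 : D)
    rw [star_one, one_mul, re_one] at h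
    nlinarith [norm_nonneg (1 : D)]

/-- `‖q*‖² = Re (q q*) = Re (q* q) = ‖q‖²` since the real part is tracial. -/
instance : NormedStarGroup D where
  norm_star_le q := by
    have h := norm_sq_eq (star q)
    rw [star_star, re_mul_comm, ← norm_sq_eq] at h
    exact ((sq_eq_sq₀ (norm_nonneg _) (norm_nonneg _)).1 h).le

/-- `‖pq‖² = Re (q* p* p q) = ‖p‖² ‖q‖²`. -/
instance : NormMulClass D where
  norm_mul p q := by
    rw [← sq_eq_sq₀ (norm_nonneg _) (by positivity), norm_sq_eq, star_mul, mul_assoc,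
      ← mul_assoc (star p), star_mul_self, Algebra.commutes, ← mul_assoc, star_mul_self,
      ← map_mul, re_algebraMap, mul_pow, mul_comm]

theorem norm_algebraMap_real (r : ℝ) : ‖algebraMap ℝ D r‖ = |r| := by
  rw [norm_algebraMap', Real.norm_eq_abs]

theorem star_algebraMap_real (r : ℝ) : star (algebraMap ℝ D r) = algebraMap ℝ D r := by
  rcases eq_or_ne r 0 with rfl | hr
  · simp
  have h := star_mul_self (algebraMap ℝ D r)
  rw [norm_algebraMap_real, sq_abs, sq, map_mul] at h
  have h2 := congrArg (· * algebraMap ℝ D r⁻¹) h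
  simpa [mul_assoc, ← map_mul, hr] using h2

theorem continuous_re : Continuous (re : D →ₗ[ℝ] ℝ) := LinearMap.continuous_of_finiteDimensional _

end HilbertScalars

namespace ScalarInnerSpace

open HilbertScalars

variable {D H : Type*} [NormedRing D] [NormedAlgebra ℝ D] [StarRing D] [HilbertScalars D]
  [NormedAddCommGroup H] [InnerProductSpace ℝ H] [Inner D H] [ScalarInnerSpace D H]

theorem inner_add_left (x y z : H) : inner D (x + y) z = inner D x z + inner D y z := by
  rw [← star_inner, inner_add_right, star_add, star_inner, star_inner]

theorem inner_zero_right (x : H) : inner D x (0 : H) = 0 := by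
  have h := inner_add_right (D := D) x 0 0
  simpa using h

theorem inner_zero_left (x : H) : inner D (0 : H) x = 0 := by
  rw [← star_inner, inner_zero_right, star_zero]

theorem inner_neg_right (x y : H) : inner D x (-y) = -inner D x y := by
  rw [eq_neg_iff_add_eq_zero, ← inner_add_right, neg_add_cancel, inner_zero_right]

theorem inner_sub_right (x y z : H) : inner D x (y - z) = inner D x y - inner D x z := by
  rw [sub_eq_add_neg, inner_add_right, inner_neg_right, sub_eq_add_neg]

theorem inner_sum_right {ι : Type*} (s : Finset ι) (x : H) (f : ι → H) :
    inner D x (∑ i ∈ s, f i) = ∑ i ∈ s, inner D x (f i) :=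
  map_sum (AddMonoidHom.mk' (fun y : H => inner D x y) (inner_add_right x)) f s

variable (D) in
theorem eq_zero_of_inner_self {x : H} (h : inner D x x = 0) : x = 0 := by
  rw [inner_self, ← map_zero (algebraMap ℝ D)] at h
  simpa using algebraMap_injective h

variable (D) in
theorem ext_inner {x y : H} (h : ∀ z : H, inner D z x = inner D z y) : x = y := by
  refine sub_eq_zero.1 (eq_zero_of_inner_self D ?_)
  rw [inner_sub_right, h, sub_self]

theorem inner_eq_zero_symm {x y : H} (h : inner D x y = 0) : inner D y x = 0 := by
  rw [← star_inner, h, star_zero]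

variable (D) in
theorem norm_sq_eq_re (x : H) : ‖x‖ ^ 2 = re (inner D x x) := by
  rw [inner_self, re_algebraMap]

theorem norm_eq_one {x : H} (h : inner D x x = 1) : ‖x‖ = 1 := by
  have := norm_sq_eq_re D x
  rw [h, re_one] at this
  nlinarith [norm_nonneg x]

theorem norm_inner_symm (x y : H) : ‖(inner D x y : D)‖ = ‖(inner D y x : D)‖ := by
  rw [← star_inner, norm_star]

end ScalarInnerSpace

namespace ScalarHilbertSpace

open HilbertScalars ScalarInnerSpace

variable {D : Type*} (R : Type*) {H : Type*} [NormedRing D] [NormedAlgebra ℝ D] [StarRing D]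
  [HilbertScalars D] [Ring R] [Algebra ℝ R] [NormedAddCommGroup H] [InnerProductSpace ℝ H]
  [Module R H] [Inner D H] [Star (H →L[R] H)] [ScalarHilbertSpace D R H]

/-- The vector `x q`. -/
def mulRight (x : H) (q : D) : H := (toScalar H q : R) • x

theorem inner_mulRight_right (x y : H) (q : D) :
    inner D x (mulRight R y q) = inner D x y * q := inner_smul_right x y q

theorem inner_mulRight_left (x y : H) (q : D) :
    inner D (mulRight R x q) y = star q * inner D x y := by
  rw [← star_inner, inner_mulRight_right, star_mul, star_inner]

theorem mulRight_add (x : H) (p q : D) : mulRight R x (p + q) = mulRight R x p + mulRight R x q := by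
  rw [mulRight, map_add, add_smul]; rfl

theorem mulRight_one (x : H) : mulRight R x (1 : D) = x :=
  ext_inner D fun z => by rw [inner_mulRight_right, mul_one]

theorem norm_mulRight (x : H) (q : D) : ‖mulRight R x q‖ = ‖x‖ * ‖q‖ := by
  rw [← sq_eq_sq₀ (norm_nonneg _) (by positivity), norm_sq_eq_re D,
    inner_mulRight_right, inner_mulRight_left, inner_self, mul_assoc, Algebra.commutes,
    ← mul_assoc, star_mul_self, ← map_mul, re_algebraMap, mul_pow, mul_comm]

theorem map_mulRight (T : H →L[R] H) (x : H) (q : D) :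
    T (mulRight R x q) = mulRight R (T x) q := map_smul T _ x

include R in
/-- The Cauchy–Schwarz inequality, from the real one applied to `x ⟨x|y⟩` and `y`. -/
theorem norm_inner_le (x y : H) : ‖(inner D x y : D)‖ ≤ ‖x‖ * ‖y‖ := by
  rcases (norm_nonneg (inner D x y : D)).eq_or_lt with h | h
  · rw [← h]; positivity
  refine le_of_mul_le_mul_right ?_ h
  rw [← sq, norm_sq_eq, ← inner_mulRight_left R, re_inner]
  refine (real_inner_le_norm _ _).trans_eq ?_
  rw [norm_mulRight]; ring

variable [IsScalarTower ℝ R H]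

theorem mulRight_algebraMap (x : H) (r : ℝ) : mulRight R x (algebraMap ℝ D r) = r • x := by
  rw [mulRight, Algebra.algebraMap_eq_smul_one, map_smul, smul_assoc]
  congr 1
  exact mulRight_one (D := D) R x

include R in
theorem inner_real_smul_right (x y : H) (r : ℝ) : inner D x (r • y) = r • inner D x y := by
  rw [← mulRight_algebraMap (D := D) R, inner_mulRight_right, ← Algebra.commutes, Algebra.smul_def]

include R in
theorem inner_real_smul_left (x y : H) (r : ℝ) : inner D (r • x) y = r • inner D x y := by
  rw [← star_inner, inner_real_smul_right R, Algebra.smul_def, star_mul, star_algebraMap_real,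
    star_inner, ← Algebra.commutes, Algebra.smul_def]

variable (D) in
/-- `⟨x|·⟩` as a continuous real-linear map. -/
def innerRight (x : H) : H →L[ℝ] D :=
  LinearMap.mkContinuous
    { toFun := fun y => inner D x y
      map_add' := inner_add_right x
      map_smul' := fun r y => inner_real_smul_right R x y r } ‖x‖ fun y => norm_inner_le R x y

@[simp]
theorem innerRight_apply (x y : H) : innerRight D R x y = inner D x y := rfl

variable (D) in
/-- `q ↦ x q` as a continuous real-linear map. -/
def mulRightCLM (x : H) : D →L[ℝ] H :=
  LinearMap.toContinuousLinearMap
    { toFun := fun q => mulRight R x q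
      map_add' := mulRight_add R x
      map_smul' := fun r q => by
        rw [mulRight, map_smul, smul_assoc]; rfl }

@[simp]
theorem mulRightCLM_apply (x : H) (q : D) : mulRightCLM D R x q = mulRight R x q := rfl

include R in
theorem continuous_inner_right (x : H) : Continuous fun y : H => (inner D x y : D) :=
  (innerRight D R x).continuous

end ScalarHilbertSpace

/-! ### Hilbert bases -/

namespace ScalarHilbertSpace

open HilbertScalars ScalarInnerSpace

/-- `N` is an orthonormal set for the `D`-valued scalar product. -/
structure IsOrthonormal (D : Type*) {H : Type*} [NormedRing D] [NormedAddCommGroup H] [Inner D H]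
    (N : Set H) : Prop where
  inner_self : ∀ u ∈ N, inner D u u = 1
  inner_ne : ∀ u ∈ N, ∀ v ∈ N, u ≠ v → inner D u v = 0

theorem _root_.TraceClass.IsHilbertBasisOf.isOrthonormal {D H : Type*} [NormedRing D]
    [NormedAddCommGroup H] [Inner D H] {V N : Set H} (h : IsHilbertBasisOf D V N) :
    IsOrthonormal D N := ⟨h.inner_self, h.inner_ne⟩

variable {D : Type*} (R : Type*) {H : Type*} [NormedRing D] [NormedAlgebra ℝ D] [StarRing D]
  [HilbertScalars D] [Ring R] [Algebra ℝ R] [NormedAddCommGroup H] [InnerProductSpace ℝ H]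
  [Module R H] [Inner D H] [Star (H →L[R] H)] [ScalarHilbertSpace D R H]
  {N : Set H}

variable (D) in
/-- The component `u ⟨u|x⟩` of `x` along `u`. -/
def component (u x : H) : H :=
  mulRight R u (inner D u x)

namespace IsOrthonormal

theorem inner_component_sum (hN : IsOrthonormal D N) (s : Finset N) (x : H) {u : N} (hu : u ∈ s) :
    inner D (u : H) (∑ v ∈ s, component D R (v : H) x) = inner D (u : H) x := by
  rw [inner_sum_right, Finset.sum_eq_single_of_mem u hu]
  · rw [component, inner_mulRight_right, hN.inner_self _ u.2, one_mul]
  · intro v _ hv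
    rw [component, inner_mulRight_right, hN.inner_ne _ u.2 _ v.2 fun h => hv (Subtype.ext h.symm),
      zero_mul]

theorem norm_component_sum_sq (hN : IsOrthonormal D N) (s : Finset N) (x : H) :
    ‖∑ v ∈ s, component D R (v : H) x‖ ^ 2 = ∑ v ∈ s, ‖(inner D (v : H) x : D)‖ ^ 2 := by
  set y := ∑ v ∈ s, component D R (v : H) x with hy
  rw [norm_sq_eq_re D]
  conv_lhs => rw [hy, inner_sum_right, ← hy, map_sum]
  refine Finset.sum_congr rfl fun u hu => ?_
  rw [component, inner_mulRight_right, ← star_inner, hN.inner_component_sum R s x hu, norm_sq_eq]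

include R in
/-- Bessel's inequality. -/
theorem sum_norm_sq_le (hN : IsOrthonormal D N) (s : Finset N) (x : H) :
    ∑ v ∈ s, ‖(inner D (v : H) x : D)‖ ^ 2 ≤ ‖x‖ ^ 2 := by
  set y := ∑ v ∈ s, component D R (v : H) x with hy
  have h1 : (inner ℝ x y : ℝ) = ∑ v ∈ s, ‖(inner D (v : H) x : D)‖ ^ 2 := by
    rw [← re_inner (D := D), hy, inner_sum_right, map_sum]
    refine Finset.sum_congr rfl fun u _ => ?_
    rw [component, inner_mulRight_right, ← star_inner, norm_sq_eq]
  have h2 := norm_sub_sq_real x y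
  rw [h1, hN.norm_component_sum_sq R s x] at h2
  nlinarith [sq_nonneg ‖x - y‖]

include R in
theorem summable_norm_sq (hN : IsOrthonormal D N) (x : H) :
    Summable fun v : N => ‖(inner D (v : H) x : D)‖ ^ 2 :=
  summable_of_sum_le (fun _ => by positivity) fun s => hN.sum_norm_sq_le R s x

include R in
theorem sum_norm_mul_norm_le (hN : IsOrthonormal D N) (s : Finset N) (x y : H) :
    ∑ v ∈ s, ‖(inner D (v : H) x : D)‖ * ‖(inner D (v : H) y : D)‖ ≤ ‖x‖ * ‖y‖ := by
  refine (Real.sum_mul_le_sqrt_mul_sqrt _ _ _).trans ?_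
  gcongr
  · exact Real.sqrt_le_iff.2 ⟨norm_nonneg _, hN.sum_norm_sq_le R s x⟩
  · exact Real.sqrt_le_iff.2 ⟨norm_nonneg _, hN.sum_norm_sq_le R s y⟩

include R in
theorem summable_norm_mul_norm (hN : IsOrthonormal D N) (x y : H) :
    Summable fun v : N => ‖(inner D (v : H) x : D)‖ * ‖(inner D (v : H) y : D)‖ :=
  summable_of_sum_le (fun _ => by positivity) fun s => hN.sum_norm_mul_norm_le R s x y

include R in
theorem tsum_norm_mul_norm_le (hN : IsOrthonormal D N) (x y : H) :
    ∑' v : N, ‖(inner D (v : H) x : D)‖ * ‖(inner D (v : H) y : D)‖ ≤ ‖x‖ * ‖y‖ :=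
  Real.tsum_le_of_sum_le (fun _ => by positivity) fun s => hN.sum_norm_mul_norm_le R s x y

theorem summable_component [CompleteSpace H] (hN : IsOrthonormal D N) (x : H) :
    Summable fun v : N => component D R (v : H) x := by
  rw [summable_iff_vanishing_norm]
  intro ε hε
  obtain ⟨s, hs⟩ := summable_iff_vanishing_norm.1 (hN.summable_norm_sq R x) (ε ^ 2) (by positivity)
  refine ⟨s, fun t ht => ?_⟩
  have h := hs t ht
  rw [← hN.norm_component_sum_sq R, Real.norm_of_nonneg (by positivity)] at h
  exact lt_of_pow_lt_pow_left₀ 2 hε.le h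

end IsOrthonormal

end ScalarHilbertSpace

namespace TraceClass

open HilbertScalars ScalarInnerSpace ScalarHilbertSpace

variable {D : Type*} (R : Type*) {H : Type*} [NormedRing D] [NormedAlgebra ℝ D] [StarRing D]
  [HilbertScalars D] [Ring R] [Algebra ℝ R] [NormedAddCommGroup H] [InnerProductSpace ℝ H]
  [Module R H] [Inner D H] [Star (H →L[R] H)] [ScalarHilbertSpace D R H] [IsScalarTower ℝ R H]
  {N : Set H}

section

variable [CompleteSpace H]

theorem IsHilbertBasisOf.hasSum_component {V : Submodule R H}
    (hN : IsHilbertBasisOf D (V : Set H) N) (hV : IsClosed (V : Set H)) {x : H} (hx : x ∈ V) :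
    HasSum (fun v : N => component D R (v : H) x) x := by
  have ho := hN.isOrthonormal
  have hs := (ho.summable_component R x).hasSum
  set y := ∑' v : N, component D R (v : H) x
  have hy : y ∈ V := hV.mem_of_tendsto hs (Eventually.of_forall fun s =>
    V.sum_mem fun v _ => V.smul_mem _ (hN.subset v.2))
  have key : x - y = 0 := by
    refine hN.total _ (V.sub_mem hx hy) fun u hu => ?_
    rw [ScalarInnerSpace.inner_sub_right, sub_eq_zero]
    refine tendsto_nhds_unique ?_
      (((continuous_inner_right (D := D) R u).tendsto y).comp hs)
    refine tendsto_const_nhds.congr' ?_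
    filter_upwards [eventually_ge_atTop {⟨u, hu⟩}] with s hsu
    exact (ho.inner_component_sum R s x (u := ⟨u, hu⟩) (by simpa using hsu)).symm
  rwa [← sub_eq_zero.1 key] at hs

theorem IsHilbertBasis.hasSum_component (hN : IsHilbertBasis D N) (x : H) :
    HasSum (fun v : N => component D R (v : H) x) x :=
  IsHilbertBasisOf.hasSum_component R (V := ⊤) hN isClosed_univ trivial

include R in
/-- Parseval's identity. -/
theorem IsHilbertBasis.hasSum_inner_mul_inner (hN : IsHilbertBasis D N) (x y : H) :
    HasSum (fun v : N => (inner D x (v : H) : D) * inner D (v : H) y) (inner D x y) := by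
  have h := (hN.hasSum_component R y).map (innerRight D R x) (innerRight D R x).continuous
  refine h.congr_fun fun v => ?_
  simp [component, inner_mulRight_right]

include R in
theorem IsHilbertBasis.hasSum_norm_sq (hN : IsHilbertBasis D N) (x : H) :
    HasSum (fun v : N => ‖(inner D (v : H) x : D)‖ ^ 2) (‖x‖ ^ 2) := by
  have h := (hN.hasSum_inner_mul_inner R x x).map (re : D →ₗ[ℝ] ℝ) continuous_re
  rw [← norm_sq_eq_re D] at h
  refine h.congr_fun fun v => ?_
  rw [norm_sq_eq, star_inner]
  rfl

end

/-- Every orthonormal subset of a subspace extends to a Hilbert basis of it. -/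
theorem exists_isHilbertBasisOf_superset {V : Submodule R H} {M : Set H} (hM : IsOrthonormal D M)
    (hMV : M ⊆ V) : ∃ N, M ⊆ N ∧ IsHilbertBasisOf D (V : Set H) N := by
  obtain ⟨N, hMN, hN⟩ := zorn_subset_nonempty {N : Set H | N ⊆ V ∧ IsOrthonormal D N} (by
    intro c hc hcc hne
    refine ⟨⋃₀ c, ⟨Set.sUnion_subset fun s hs => (hc hs).1, ⟨?_, ?_⟩⟩,
      fun s hs => Set.subset_sUnion_of_mem hs⟩
    · rintro u ⟨s, hs, hu⟩
      exact (hc hs).2.inner_self u hu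
    · rintro u ⟨s, hs, hu⟩ v ⟨t, ht, hv⟩ huv
      rcases hcc.total hs ht with h | h
      · exact (hc ht).2.inner_ne u (h hu) v hv huv
      · exact (hc hs).2.inner_ne u hu v (h hv) huv) M ⟨hMV, hM⟩
  obtain ⟨⟨hNV, hNo⟩, hmax⟩ := hN
  -- a non-zero vector of `V` orthogonal to `N` could be normalized and added to `N`
  refine ⟨N, hMN, hNV, hNo.inner_self, hNo.inner_ne, fun x hx hxN => ?_⟩
  by_contra hx0
  have hn : ‖x‖ ≠ 0 := norm_ne_zero_iff.2 hx0
  set y := mulRight R x (algebraMap ℝ D ‖x‖⁻¹) with hy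
  have hyy : inner D y y = 1 := by
    rw [inner_self, hy, mulRight_algebraMap, norm_smul, norm_inv, norm_norm, inv_mul_cancel₀ hn]
    simp
  have hyN : ∀ u ∈ N, inner D u y = 0 := fun u hu => by
    rw [hy, inner_mulRight_right, hxN u hu, zero_mul]
  have hins : y ∈ N := by
    refine hmax (y := insert y N) ⟨Set.insert_subset (V.smul_mem _ hx) hNV, ⟨?_, ?_⟩⟩
      (Set.subset_insert _ _) (Set.mem_insert _ _)
    · rintro u (rfl | hu)
      exacts [hyy, hNo.inner_self u hu]
    · rintro u (rfl | hu) v (rfl | hv) huv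
      · exact absurd rfl huv
      · exact inner_eq_zero_symm (hyN v hv)
      · exact hyN u hu
      · exact hNo.inner_ne u hu v hv huv
  rw [hyN y hins] at hyy
  have := congrArg (re : D → ℝ) hyy
  rw [map_zero, re_one] at this
  exact zero_ne_one this

theorem exists_isHilbertBasisOf (D : Type*) [NormedRing D] [NormedAlgebra ℝ D] [StarRing D]
    [HilbertScalars D] [Inner D H] [ScalarHilbertSpace D R H] (V : Submodule R H) :
    ∃ N, IsHilbertBasisOf D (V : Set H) N :=
  let ⟨N, _, hN⟩ := exists_isHilbertBasisOf_superset (D := D) R (V := V) (M := ∅)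
    ⟨by simp, by simp⟩ (by simp)
  ⟨N, hN⟩

/-! ### Nuclear series and traces -/

variable {R}

/-- `T x = ∑ᵢ aᵢ ⟨bᵢ|x⟩` for all `x`, with `∑ᵢ ‖aᵢ‖ ‖bᵢ‖ < ∞`. -/
structure HasNuclearSeries (D : Type*) [NormedRing D] [NormedAlgebra ℝ D] [StarRing D]
    [HilbertScalars D] [Inner D H] [ScalarHilbertSpace D R H] {ι : Type*} (T : H →L[R] H)
    (a b : ι → H) : Prop where
  summable : Summable fun i => ‖a i‖ * ‖b i‖
  hasSum : ∀ x, HasSum (fun i => mulRight R (a i) (inner D (b i) x)) (T x)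

namespace HasNuclearSeries

variable {ι : Type*} {T : H →L[R] H} {a b : ι → H}

theorem mul_left (h : HasNuclearSeries D T a b) (B : H →L[R] H) :
    HasNuclearSeries D (B * T) (fun i => B (a i)) b where
  summable := by
    refine Summable.of_nonneg_of_le (fun _ => by positivity) (fun i => ?_)
      (h.summable.mul_left ‖B.restrictScalars ℝ‖)
    rw [← mul_assoc]
    gcongr
    exact (B.restrictScalars ℝ).le_opNorm _
  hasSum x := by
    have := (h.hasSum x).map B B.continuous
    refine this.congr_fun fun i => ?_
    rw [Function.comp_apply, map_mulRight]

theorem mul_right (h : HasNuclearSeries D T a b) (B : H →L[R] H) :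
    HasNuclearSeries D (T * B) a (fun i => star B (b i)) where
  summable := by
    refine Summable.of_nonneg_of_le (fun _ => by positivity) (fun i => ?_)
      (h.summable.mul_left ‖(star B).restrictScalars ℝ‖)
    rw [mul_left_comm]
    gcongr
    exact ((star B).restrictScalars ℝ).le_opNorm _
  hasSum x := by
    simp only [inner_star_left]
    exact h.hasSum (B x)

theorem hasSum_inner (h : HasNuclearSeries D T a b) (x y : H) :
    HasSum (fun i => (inner D y (a i) : D) * inner D (b i) x) (inner D y (T x)) := by
  have := (h.hasSum x).map (innerRight D R y) (innerRight D R y).continuous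
  refine this.congr_fun fun i => ?_
  simp [inner_mulRight_right]

theorem summable_prod (h : HasNuclearSeries D T a b) (hN : IsHilbertBasis D N) :
    Summable fun p : ι × N => ‖(inner D (p.2 : H) (a p.1) : D) * inner D (b p.1) (p.2 : H)‖ := by
  have ho := hN.isOrthonormal
  have hn : ∀ p : ι × N, ‖(inner D (p.2 : H) (a p.1) : D) * inner D (b p.1) (p.2 : H)‖ =
      ‖(inner D (p.2 : H) (a p.1) : D)‖ * ‖(inner D (p.2 : H) (b p.1) : D)‖ := fun p => by
    rw [norm_mul, ScalarInnerSpace.norm_inner_symm (D := D) (b p.1)]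
  simp only [hn]
  rw [summable_prod_of_nonneg fun _ => mul_nonneg (norm_nonneg _) (norm_nonneg _)]
  exact ⟨fun i => ho.summable_norm_mul_norm R (a i) (b i),
    Summable.of_nonneg_of_le (fun i => tsum_nonneg fun _ => mul_nonneg (norm_nonneg _) (norm_nonneg _))
      (fun i => ho.tsum_norm_mul_norm_le R (a i) (b i)) h.summable⟩

theorem tsum_prod_le (h : HasNuclearSeries D T a b) (hN : IsHilbertBasis D N) :
    ∑' p : ι × N, ‖(inner D (p.2 : H) (a p.1) : D) * inner D (b p.1) (p.2 : H)‖ ≤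
      ∑' i, ‖a i‖ * ‖b i‖ := by
  have hs := h.summable_prod hN
  rw [hs.tsum_prod]
  refine Summable.tsum_le_tsum (fun i => ?_) hs.prod h.summable
  simp only [norm_mul, ScalarInnerSpace.norm_inner_symm (D := D) (b i)]
  exact hN.isOrthonormal.tsum_norm_mul_norm_le R (a i) (b i)

theorem norm_inner_le_tsum (h : HasNuclearSeries D T a b) (hN : IsHilbertBasis D N) (u : N) :
    ‖(inner D (u : H) (T u) : D)‖ ≤
      ∑' i, ‖(inner D (u : H) (a i) : D) * inner D (b i) (u : H)‖ := by
  rw [← (h.hasSum_inner (u : H) (u : H)).tsum_eq]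
  exact norm_tsum_le_tsum_norm
    ((h.summable_prod hN).prod_symm.prod_factor u)

theorem summable_norm (h : HasNuclearSeries D T a b) (hN : IsHilbertBasis D N) :
    Summable fun u : N => ‖(inner D (u : H) (T u) : D)‖ :=
  Summable.of_nonneg_of_le (fun _ => norm_nonneg _) (h.norm_inner_le_tsum hN)
    (h.summable_prod hN).prod_symm.prod

theorem tsum_norm_le (h : HasNuclearSeries D T a b) (hN : IsHilbertBasis D N) :
    ∑' u : N, ‖(inner D (u : H) (T u) : D)‖ ≤ ∑' i, ‖a i‖ * ‖b i‖ := by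
  refine le_trans ?_ (h.tsum_prod_le hN)
  have hs := (h.summable_prod hN).prod_symm
  refine (Summable.tsum_le_tsum (h.norm_inner_le_tsum hN) (h.summable_norm hN) hs.prod).trans_eq ?_
  rw [← (Equiv.prodComm N ι).tsum_eq]
  exact hs.tsum_prod.symm

theorem norm_traceOn_le (h : HasNuclearSeries D T a b) (hN : IsHilbertBasis D N) :
    ‖traceOn D N T‖ ≤ ∑' i, ‖a i‖ * ‖b i‖ :=
  (norm_tsum_le_tsum_norm (h.summable_norm hN)).trans (h.tsum_norm_le hN)

theorem hasSum_traceOn (h : HasNuclearSeries D T a b) (hN : IsHilbertBasis D N) :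
    HasSum (fun u : N => inner D (u : H) (T u)) (traceOn D N T) :=
  have : CompleteSpace D := FiniteDimensional.complete ℝ D
  (h.summable_norm hN).of_norm.hasSum

/-- A tracial functional `φ` of the `N`-trace does not depend on the Hilbert basis `N`: exchange
the two summations and use Parseval's identity. -/
theorem map_traceOn [CompleteSpace H] (h : HasNuclearSeries D T a b) (hN : IsHilbertBasis D N)
    {E : Type*} [NormedAddCommGroup E] [NormedSpace ℝ E] (φ : D →ₗ[ℝ] E)
    (hφ : ∀ p q, φ (p * q) = φ (q * p)) :
    φ (traceOn D N T) = ∑' i, φ (inner D (b i) (a i)) := by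
  have : CompleteSpace D := FiniteDimensional.complete ℝ D
  have hc : Continuous φ := LinearMap.continuous_of_finiteDimensional φ
  have hs : Summable fun p : ι × N => φ (inner D (p.2 : H) (a p.1) * inner D (b p.1) (p.2 : H)) :=
    (h.summable_prod hN).of_norm.map φ hc
  -- both iterated sums equal the unconditional double sum
  have h1 := hs.hasSum.prod_fiberwise fun i => by
    have := (hN.hasSum_inner_mul_inner R (b i) (a i)).map φ hc
    exact this.congr_fun fun u => hφ _ _
  have h2 := ((Equiv.prodComm N ι).hasSum_iff.2 hs.hasSum).prod_fiberwise fun u =>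
    (h.hasSum_inner (u : H) (u : H)).map φ hc
  rw [h1.tsum_eq]
  exact ((h.hasSum_traceOn hN).map φ hc).unique h2

end HasNuclearSeries

end TraceClass

/-! ### Eigenvectors of positive operators with summable diagonal -/

namespace TraceClass

open HilbertScalars ScalarInnerSpace ScalarHilbertSpace

variable {D : Type*} {R : Type*} {H : Type*} [NormedRing D] [NormedAlgebra ℝ D] [StarRing D]
  [HilbertScalars D] [Ring R] [Algebra ℝ R] [NormedAddCommGroup H] [InnerProductSpace ℝ H]
  [Module R H] [Inner D H] [Star (H →L[R] H)] [ScalarHilbertSpace D R H]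
  {S : H →L[R] H} {N : Set H}

theorem inner_star_right (A : H →L[R] H) (x y : H) :
    inner D x (star A y) = inner D (A x) y := by
  rw [← star_inner, inner_star_left, star_inner]

theorem IsPositive.real_inner_nonneg (hS : IsPositive D S) (x : H) : 0 ≤ inner ℝ x (S x) := by
  obtain ⟨r, hr, h⟩ := hS x
  rw [← re_inner (D := D), h, re_algebraMap]
  exact hr

variable (D) in
include D in
theorem real_inner_symm_of_star_eq (hS : star S = S) (x y : H) :
    inner ℝ (S x) y = inner ℝ x (S y) := by
  rw [← re_inner (D := D), ← re_inner (D := D), ← inner_star_left, hS]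

variable [IsScalarTower ℝ R H]

/-- The Cauchy–Schwarz inequality for the form `⟨x|Sy⟩` gives `‖S u‖² ≤ ‖S‖ ⟨u|Su⟩`. -/
theorem IsPositive.norm_apply_sq_le (hp : IsPositive D S) (hS : star S = S) (u : H) :
    ‖S u‖ ^ 2 ≤ ‖S.restrictScalars ℝ‖ * inner ℝ u (S u) := by
  set c := ‖S.restrictScalars ℝ‖ with hc
  have hle : ∀ x, ‖S x‖ ≤ c * ‖x‖ := fun x => (S.restrictScalars ℝ).le_opNorm x
  rcases (norm_nonneg (S.restrictScalars ℝ)).eq_or_lt with h0 | h0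
  · have := hle u
    rw [hc, ← h0, zero_mul] at this
    have h1 : ‖S u‖ = 0 := le_antisymm this (norm_nonneg _)
    rw [h1, hc, ← h0]; simp
  rw [← hc] at h0
  have hreal : ∀ (r : ℝ) (x : H), S (r • x) = r • S x := fun r x =>
    (S.restrictScalars ℝ).map_smul r x
  -- positivity at `c u - S u`
  have key := hp.real_inner_nonneg (c • u - S u)
  have h1 : inner ℝ (S u) (S (S u)) ≤ c * ‖S u‖ ^ 2 := by
    refine (real_inner_le_norm _ _).trans ?_
    nlinarith [hle (S u), norm_nonneg (S u)]
  rw [map_sub, hreal, inner_sub_left, _root_.inner_sub_right, _root_.inner_sub_right,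
    real_inner_smul_left, real_inner_smul_left, real_inner_smul_right, real_inner_smul_right,
    ← real_inner_symm_of_star_eq D hS u (S u), real_inner_self_eq_norm_sq] at key
  have h2 : 0 ≤ c * (c * inner ℝ u (S u) - ‖S u‖ ^ 2) := by linarith
  have := nonneg_of_mul_nonneg_right h2 h0
  linarith

theorem mem_eigenspace_iff {s : ℝ} {x : H} : x ∈ eigenspace S s ↔ S x = s • x := by
  change S x = algebraMap ℝ R s • x ↔ _
  rw [algebraMap_smul]

theorem isClosed_eigenspace (s : ℝ) : IsClosed (eigenspace S s : Set H) := by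
  have : (eigenspace S s : Set H) = {x | S x = s • x} := Set.ext fun x => mem_eigenspace_iff
  rw [this]
  exact isClosed_eq S.continuous (continuous_const_smul s)

variable (D) in
theorem inner_eq_zero_of_mem_eigenspace (hS : star S = S) {s t : ℝ} (hst : s ≠ t) {x y : H}
    (hx : x ∈ eigenspace S s) (hy : y ∈ eigenspace S t) : inner D x y = 0 := by
  have h : inner D (S x) y = inner D x (S y) := by rw [← inner_star_left, hS]
  rw [mem_eigenspace_iff.1 hx, mem_eigenspace_iff.1 hy, inner_real_smul_right R,
    inner_real_smul_left R, ← sub_eq_zero, ← sub_smul] at h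
  exact (smul_eq_zero.1 h).resolve_left (sub_ne_zero.2 hst)

theorem IsPositive.eigenvalue_nonneg (hp : IsPositive D S) {s : ℝ}
    (hs : s ∈ realPointSpectrum S) : 0 ≤ s := by
  obtain ⟨x, hx, hx0⟩ := Submodule.exists_mem_ne_zero_of_ne_bot hs
  have h := hp.real_inner_nonneg x
  rw [mem_eigenspace_iff.1 hx, real_inner_smul_right, real_inner_self_eq_norm_sq] at h
  exact nonneg_of_mul_nonneg_left h (by positivity)

variable [CompleteSpace H]

variable (D) in
/-- A Hilbert–Schmidt operator is compact: it is the norm limit of its compositions with the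
projections onto finitely many vectors of the Hilbert basis. -/
theorem isCompactOperator_of_summable_norm_sq (hN : IsHilbertBasis D N)
    (h : Summable fun u : N => ‖S u‖ ^ 2) : IsCompactOperator (S.restrictScalars ℝ) := by
  have : ProperSpace D := FiniteDimensional.proper ℝ D
  classical
  let F : Finset N → H →L[ℝ] H := fun s =>
    ∑ u ∈ s, (mulRightCLM D R (S u)).comp (innerRight D R (u : H))
  have hF : ∀ s x, F s x = ∑ u ∈ s, mulRight R (S u) (inner D (u : H) x) := fun s x => by
    simp [F]
  refine isCompactOperator_of_tendsto (F := F) (l := atTop) ?_ (Eventually.of_forall fun s => ?_)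
  · rw [Metric.tendsto_nhds]
    intro ε hε
    obtain ⟨s₀, hs₀⟩ := summable_iff_vanishing_norm.1 h ((ε / 2) ^ 2) (by positivity)
    filter_upwards [eventually_ge_atTop s₀] with s hs
    rw [dist_eq_norm, norm_sub_rev]
    refine lt_of_le_of_lt (ContinuousLinearMap.opNorm_le_bound _ (half_pos hε).le fun x => ?_)
      (half_lt_self hε)
    have hx : Tendsto (fun t => F t x) atTop (𝓝 (S x)) := by
      have := (hN.hasSum_component R x).map S S.continuous
      refine Tendsto.congr (fun t => ?_) this
      rw [hF]
      exact Finset.sum_congr rfl fun u _ => map_mulRight R S _ _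
    refine le_of_tendsto ((hx.sub_const (F s x)).norm) ?_
    filter_upwards [eventually_ge_atTop s] with t ht
    rw [hF, hF, ← Finset.sum_sdiff ht, add_sub_cancel_right]
    have hd : Disjoint (t \ s) s₀ := Finset.disjoint_of_subset_right hs Finset.sdiff_disjoint
    have h1 := hs₀ _ hd
    rw [Real.norm_of_nonneg (Finset.sum_nonneg fun _ _ => by positivity)] at h1
    refine (norm_sum_le _ _).trans ?_
    simp only [norm_mulRight]
    refine (Real.sum_mul_le_sqrt_mul_sqrt _ _ _).trans ?_
    gcongr
    · exact Real.sqrt_le_iff.2 ⟨by positivity, h1.le⟩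
    · exact Real.sqrt_le_iff.2 ⟨norm_nonneg _, hN.isOrthonormal.sum_norm_sq_le R _ x⟩
  · exact Submodule.sum_mem (compactOperator (RingHom.id ℝ) H H) fun u _ =>
      (isCompactOperator_of_locallyCompactSpace_dom (innerRight D R (u : H))).clm_comp
        (mulRightCLM D R (S u))

/-- The diagonal of `S` in the Hilbert basis `N` is summable, for `S ≥ 0` self-adjoint. -/
structure HasSummableDiagonal (D : Type*) [NormedRing D] [NormedAlgebra ℝ D] [StarRing D]
    [HilbertScalars D] [Inner D H] [ScalarHilbertSpace D R H] (S : H →L[R] H) (N : Set H) :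
    Prop where
  star_eq : star S = S
  positive : IsPositive D S
  basis : IsHilbertBasis D N
  summable : Summable fun u : N => inner D (u : H) (S u)

namespace HasSummableDiagonal

theorem summable_real (h : HasSummableDiagonal D S N) :
    Summable fun u : N => (inner ℝ (u : H) (S u) : ℝ) :=
  (h.summable.map (re : D →ₗ[ℝ] ℝ) continuous_re).congr fun _ => re_inner _ _

theorem isCompactOperator (h : HasSummableDiagonal D S N) :
    IsCompactOperator (S.restrictScalars ℝ) :=
  isCompactOperator_of_summable_norm_sq D h.basis <|
    Summable.of_nonneg_of_le (fun _ => by positivity)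
      (fun u => h.positive.norm_apply_sq_le h.star_eq (u : H))
      (h.summable_real.mul_left _)

theorem eq_zero_of_forall_eigenspace (h : HasSummableDiagonal D S N) {x : H}
    (hx : ∀ s : ℝ, ∀ y ∈ eigenspace S s, inner D y x = 0) : x = 0 := by
  have hsymm : (S.restrictScalars ℝ).IsSymmetric := fun x y =>
    real_inner_symm_of_star_eq D h.star_eq x y
  have hbot := ContinuousLinearMap.orthogonalComplement_iSup_eigenspaces_eq_bot
    h.isCompactOperator hsymm
  rw [← Submodule.mem_bot ℝ, ← hbot, ← Submodule.iInf_orthogonal, Submodule.mem_iInf]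
  intro s
  rw [Submodule.mem_orthogonal]
  intro y hy
  rw [← re_inner (D := D), hx s y, map_zero]
  exact mem_eigenspace_iff.2 (Module.End.mem_eigenspace_iff.1 hy)

/-- The spectral theorem: Hilbert bases of the eigenspaces unite to a Hilbert basis of `H`. -/
theorem exists_eigenbasis (h : HasSummableDiagonal D S N) :
    ∃ B : realPointSpectrum S → Set H,
      (∀ s : realPointSpectrum S, IsHilbertBasisOf D (eigenspace S (s : ℝ) : Set H) (B s)) ∧
      IsHilbertBasis D (⋃ s, B s) := by
  choose B hB using fun s : realPointSpectrum S =>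
    exists_isHilbertBasisOf R D (eigenspace S (s : ℝ))
  refine ⟨B, hB, Set.subset_univ _, ?_, ?_, ?_⟩
  · intro u hu
    obtain ⟨s, hu⟩ := Set.mem_iUnion.1 hu
    exact (hB s).inner_self u hu
  · intro u hu v hv huv
    obtain ⟨s, hu⟩ := Set.mem_iUnion.1 hu
    obtain ⟨t, hv⟩ := Set.mem_iUnion.1 hv
    rcases eq_or_ne s t with rfl | hst
    · exact (hB s).inner_ne u hu v hv huv
    · exact inner_eq_zero_of_mem_eigenspace D h.star_eq (fun e => hst (Subtype.ext e))
        ((hB s).subset hu) ((hB t).subset hv)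
  · intro x _ hx
    refine h.eq_zero_of_forall_eigenspace fun s y hy => ?_
    by_cases hs : s ∈ realPointSpectrum S
    · have hsum := (hB ⟨s, hs⟩).hasSum_component R (isClosed_eigenspace s) hy
      have h2 := hsum.map (innerRight D R x) (innerRight D R x).continuous
      refine inner_eq_zero_symm (h2.unique (hasSum_zero.congr_fun fun u => ?_))
      have hu : inner D x (u : H) = 0 :=
        inner_eq_zero_symm (hx u (Set.mem_iUnion.2 ⟨⟨s, hs⟩, u.2⟩))
      simp [component, inner_mulRight_right, hu]
    · have : y ∈ (⊥ : Submodule R H) := by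
        rw [← not_not.1 hs]; exact hy
      rw [(Submodule.mem_bot R).1 this, ScalarInnerSpace.inner_zero_left]

end HasSummableDiagonal

end TraceClass

/-! ### The absolute value and the trace norm -/

namespace TraceClass

open HilbertScalars ScalarInnerSpace ScalarHilbertSpace

variable {D : Type*} {R : Type*} {H : Type*} [NormedRing D] [NormedAlgebra ℝ D] [StarRing D]
  [HilbertScalars D] [Ring R] [Algebra ℝ R] [NormedAddCommGroup H] [InnerProductSpace ℝ H]
  [Module R H] [Inner D H] [Star (H →L[R] H)] [ScalarHilbertSpace D R H]
  [IsScalarTower ℝ R H] [CompleteSpace H] {S T : H →L[R] H} {N : Set H}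

variable (R) in
/-- A finite orthonormal basis is a basis of the `R`-module, so its cardinality is the dimension. -/
theorem IsHilbertBasisOf.toENat_rank [StrongRankCondition R] {V : Submodule R H}
    (hN : IsHilbertBasisOf D (V : Set H) N) (hV : IsClosed (V : Set H)) (hfin : N.Finite) :
    Cardinal.toENat (Module.rank R V) = ENat.card N := by
  have := hfin.fintype
  let v : N → V := fun u => ⟨u, hN.subset u.2⟩
  have hind : LinearIndependent R v := by
    classical
    rw [Fintype.linearIndependent_iff]
    intro g hg u
    have h1 : ∑ w : N, mulRight R (w : H) ((toScalar H).symm (g w) : D) = 0 := by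
      have := congrArg (Subtype.val : V → H) hg
      simpa [v, mulRight] using this
    have h2 := congrArg (fun x => inner D (u : H) x) h1
    simp only [inner_sum_right, inner_mulRight_right, ScalarInnerSpace.inner_zero_right] at h2
    rw [Finset.sum_eq_single_of_mem u (Finset.mem_univ u), hN.inner_self _ u.2, one_mul] at h2
    · simpa using h2
    · intro w _ hw
      rw [hN.inner_ne _ u.2 _ w.2 fun h => hw (Subtype.ext h.symm), zero_mul]
  have hspan : ⊤ ≤ Submodule.span R (Set.range v) := by
    rintro ⟨x, hx⟩ -
    have h1 : ∑ w : N, component D R (w : H) x = x :=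
      (hasSum_fintype _).unique (hN.hasSum_component R hV hx)
    have h2 : (⟨x, hx⟩ : V) = ∑ w : N, (toScalar H (inner D (w : H) x) : R) • v w := by
      refine Subtype.ext ?_
      rw [AddSubmonoidClass.coe_finsetSum]
      exact h1.symm
    rw [h2]
    exact Submodule.sum_mem _ fun w _ => Submodule.smul_mem _ _
      (Submodule.subset_span (Set.mem_range_self w))
  rw [rank_eq_card_basis (Module.Basis.mk hind hspan)]
  simp

namespace HasSummableDiagonal

theorem norm_apply_of_mem_eigenspace (h : HasSummableDiagonal D S N) {s : ℝ} {e : H}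
    (hs : s ∈ realPointSpectrum S) (he : e ∈ eigenspace S s) (h1 : inner D e e = 1) :
    ‖S e‖ = s := by
  rw [mem_eigenspace_iff.1 he, norm_smul, norm_eq_one h1, mul_one,
    Real.norm_of_nonneg (h.positive.eigenvalue_nonneg hs)]

/-- The sum of the eigenvalues equals the sum of the diagonal of `S` in the Hilbert basis `N`. -/
theorem tsum_eigenbasis (h : HasSummableDiagonal D S N) {B : realPointSpectrum S → Set H}
    (hB : ∀ s : realPointSpectrum S, IsHilbertBasisOf D (eigenspace S (s : ℝ) : Set H) (B s))
    (hM : IsHilbertBasis D (⋃ s, B s)) :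
    ∑' e : ⋃ s, B s, ENNReal.ofReal ‖S e‖ = ∑' u : N, ENNReal.ofReal (inner ℝ (u : H) (S u)) := by
  have heig : ∀ e : ⋃ s, B s, S e = ‖S e‖ • (e : H) := fun e => by
    obtain ⟨s, he⟩ := Set.mem_iUnion.1 e.2
    rw [h.norm_apply_of_mem_eigenspace s.2 ((hB s).subset he) ((hB s).inner_self _ he)]
    exact mem_eigenspace_iff.1 ((hB s).subset he)
  -- expand `⟨u|Su⟩` in the eigenbasis and sum over `u`, using Parseval's identity for each `e`
  have hu : ∀ u : H, ENNReal.ofReal (inner ℝ u (S u)) =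
      ∑' e : ⋃ s, B s, ENNReal.ofReal ‖S e‖ * ENNReal.ofReal (‖(inner D (e : H) u : D)‖ ^ 2) := by
    intro u
    have hsum : HasSum (fun e : ⋃ s, B s => ‖S e‖ * ‖(inner D (e : H) u : D)‖ ^ 2)
        (inner ℝ u (S u)) := by
      have h1 := (hM.hasSum_inner_mul_inner R (S u) u).map (re : D →ₗ[ℝ] ℝ) continuous_re
      rw [re_inner, real_inner_comm] at h1
      refine h1.congr_fun fun e => ?_
      have h2 : inner D (S u) (e : H) = ‖S e‖ • inner D u (e : H) := by
        rw [← inner_real_smul_right R, ← heig e, ← inner_star_left, h.star_eq]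
      rw [Function.comp_apply, h2, smul_mul_assoc, map_smul, smul_eq_mul, norm_sq_eq, star_inner]
    rw [← hsum.tsum_eq, ENNReal.ofReal_tsum_of_nonneg (fun _ => by positivity) hsum.summable]
    exact tsum_congr fun e => ENNReal.ofReal_mul (norm_nonneg _)
  have he : ∀ e : ⋃ s, B s, ∑' u : N, ENNReal.ofReal (‖(inner D (e : H) (u : H) : D)‖ ^ 2) = 1 := by
    intro e
    have h1 := h.basis.hasSum_norm_sq R (e : H)
    rw [norm_eq_one (hM.inner_self _ e.2)] at h1
    simp only [ScalarInnerSpace.norm_inner_symm (D := D) (e : H)]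
    rw [← ENNReal.ofReal_tsum_of_nonneg (fun _ => by positivity) h1.summable, h1.tsum_eq]
    simp
  simp only [hu]
  rw [ENNReal.tsum_comm]
  refine tsum_congr fun e => ?_
  rw [ENNReal.tsum_mul_left, he, mul_one]

theorem tsum_eigenbasis_ne_top (h : HasSummableDiagonal D S N) {B : realPointSpectrum S → Set H}
    (hB : ∀ s : realPointSpectrum S, IsHilbertBasisOf D (eigenspace S (s : ℝ) : Set H) (B s))
    (hM : IsHilbertBasis D (⋃ s, B s)) :
    ∑' e : ⋃ s, B s, ENNReal.ofReal ‖S e‖ ≠ ⊤ := by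
  rw [h.tsum_eigenbasis hB hM, ← ENNReal.ofReal_tsum_of_nonneg
    (fun _ => h.positive.real_inner_nonneg _) h.summable_real]
  exact ENNReal.ofReal_ne_top

/-- Counting eigenvalues with multiplicity is summing over a Hilbert basis of eigenvectors. -/
theorem tsum_eigenDim [StrongRankCondition R] (h : HasSummableDiagonal D S N)
    {B : realPointSpectrum S → Set H}
    (hB : ∀ s : realPointSpectrum S, IsHilbertBasisOf D (eigenspace S (s : ℝ) : Set H) (B s))
    (hM : IsHilbertBasis D (⋃ s, B s)) :
    ∑' s : realPointSpectrum S, ENNReal.ofReal (s : ℝ) * (eigenDim S (s : ℝ) : ENNReal) =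
      ∑' e : ⋃ s, B s, ENNReal.ofReal ‖S e‖ := by
  have hn : ∀ s, ∀ e : B s, ‖S e‖ = s := fun s e =>
    h.norm_apply_of_mem_eigenspace s.2 ((hB s).subset e.2) ((hB s).inner_self _ e.2)
  have hdisj : Pairwise (Function.onFun Disjoint B) := fun s t hst =>
    Set.disjoint_left.2 fun e hs ht => hst <| Subtype.ext <| by
      rw [← hn s ⟨e, hs⟩, ← hn t ⟨e, ht⟩]
  have hsum : ∑' e : ⋃ s, B s, ENNReal.ofReal ‖S e‖ =
      ∑' s : realPointSpectrum S, ENNReal.ofReal (s : ℝ) * (ENat.card (B s) : ENNReal) := by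
    rw [← (Set.unionEqSigmaOfDisjoint hdisj).symm.tsum_eq, ENNReal.tsum_sigma']
    refine tsum_congr fun s => ?_
    rw [mul_comm, ← ENNReal.tsum_const]
    exact tsum_congr fun e => congrArg _ (hn s e)
  rw [hsum]
  refine tsum_congr fun s => ?_
  rcases (h.positive.eigenvalue_nonneg s.2).eq_or_lt with h0 | h0
  · simp [← h0]
  -- for `s > 0` an infinite-dimensional eigenspace would contribute `∞` to the sum
  have hfin : (B s).Finite := by
    by_contra hinf
    have hinf' : Infinite (B s) := Set.infinite_coe_iff.2 hinf
    refine h.tsum_eigenbasis_ne_top hB hM (top_unique ?_)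
    rw [hsum]
    refine le_trans (le_of_eq ?_) (ENNReal.le_tsum s)
    rw [ENat.card_eq_top_of_infinite, ENat.toENNReal_top, ENNReal.mul_top (by simpa using h0)]
  rw [eigenDim, (hB s).toENat_rank R (isClosed_eigenspace _) hfin]

/-- A square root of `S²` that is positive and self-adjoint is `S`: it agrees with `S` on the
eigenvectors of `S`. -/
theorem eq_of_mul_self_eq (h : HasSummableDiagonal D S N) {S' : H →L[R] H} (hS' : star S' = S')
    (hp : IsPositive D S') (he : S' * S' = S * S) : S' = S := by
  obtain ⟨B, hB, hM⟩ := h.exists_eigenbasis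
  have hSS : ∀ x, S' (S' x) = S (S x) := fun x => congrArg (fun A : H →L[R] H => A x) he
  have hreal : ∀ (A : H →L[R] H) (r : ℝ) (x : H), A (r • x) = r • A x := fun A r x =>
    (A.restrictScalars ℝ).map_smul r x
  have key : ∀ e : ⋃ s, B s, S' e = S e := by
    rintro ⟨e, hemem⟩
    obtain ⟨s, hes⟩ := Set.mem_iUnion.1 hemem
    have hSe := mem_eigenspace_iff.1 ((hB s).subset hes)
    have h2 : S' (S' e) = (s : ℝ) • (s : ℝ) • e := by rw [hSS, hSe, hreal, hSe]
    change S' e = S e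
    rw [hSe]
    rcases (h.positive.eigenvalue_nonneg s.2).eq_or_lt with h0 | h0
    -- for `s = 0`, `‖S' e‖² = ⟨e|S'S' e⟩ = 0`
    · rw [← h0, zero_smul] at h2 ⊢
      rw [← inner_self_eq_zero (𝕜 := ℝ), real_inner_symm_of_star_eq D hS', h2,
        _root_.inner_zero_right]
    -- for `s > 0`, `w = S' e - s e` satisfies `S' w = -s w`, so `w = 0` by positivity of `S'`
    · have h3 : S' (S' e - (s : ℝ) • e) = -((s : ℝ) • (S' e - (s : ℝ) • e)) := by
        rw [map_sub, h2, hreal, smul_sub]; abel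
      have h4 := hp.real_inner_nonneg (S' e - (s : ℝ) • e)
      rw [h3, _root_.inner_neg_right, real_inner_smul_right, real_inner_self_eq_norm_sq] at h4
      have h5 : ‖S' e - (s : ℝ) • e‖ ^ 2 ≤ 0 := by
        by_contra hc
        push Not at hc
        nlinarith [mul_pos h0 hc]
      have h6 : ‖S' e - (s : ℝ) • e‖ = 0 := by nlinarith [norm_nonneg (S' e - (s : ℝ) • e)]
      exact sub_eq_zero.1 (norm_eq_zero.1 h6)
  ext x
  have hx := hM.hasSum_component R x
  refine (hx.map S' S'.continuous).unique ((hx.map S S.continuous).congr_fun fun e => ?_)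
  rw [Function.comp_apply, Function.comp_apply, component, map_mulRight, map_mulRight, key]

end HasSummableDiagonal

theorem IsAbs.norm_apply (h : IsAbs D T S) (x : H) : ‖T x‖ = ‖S x‖ := by
  have h1 : inner D (T x) (T x) = inner D (S x) (S x) := by
    have : (S * S) x = (star T * T) x := by rw [h.mul_self]
    rw [← inner_star_right, ← inner_star_right, h.selfAdjoint]
    exact congrArg _ this.symm
  rw [← sq_eq_sq₀ (norm_nonneg _) (norm_nonneg _), norm_sq_eq_re D, norm_sq_eq_re D, h1]

/-- A trace class operator has a nuclear series with `∑ ‖aᵢ‖ ‖bᵢ‖ = ‖T‖₁`: expand in a Hilbert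
basis `(e)` of eigenvectors of `|T|`, so that `T x = ∑ (T e) ⟨e|x⟩` with `‖T e‖ = ‖|T| e‖`. -/
theorem IsTraceClass.exists_hasNuclearSeries [StrongRankCondition R] (hT : IsTraceClass D T) :
    traceNorm D T ≠ ⊤ ∧ ∃ (M : Set H) (a b : M → H), HasNuclearSeries D T a b ∧
      ∑' i, ‖a i‖ * ‖b i‖ = (traceNorm D T).toReal := by
  obtain ⟨S, hS, N, hN, hsum⟩ := hT
  have h : HasSummableDiagonal D S N := ⟨hS.selfAdjoint, hS.positive, hN, hsum⟩
  have habs : absOp D T = S := by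
    have h' : IsAbs D T (absOp D T) := Classical.epsilon_spec (p := fun S => IsAbs D T S) ⟨S, hS⟩
    exact h.eq_of_mul_self_eq h'.selfAdjoint h'.positive (h'.mul_self.trans hS.mul_self.symm)
  obtain ⟨B, hB, hM⟩ := h.exists_eigenbasis
  have htop := h.tsum_eigenbasis_ne_top hB hM
  have hnorm : traceNorm D T = ∑' e : ⋃ s, B s, ENNReal.ofReal (‖T e‖ * ‖(e : H)‖) := by
    rw [traceNorm, habs, h.tsum_eigenDim hB hM]
    refine tsum_congr fun e => ?_
    rw [norm_eq_one (hM.inner_self _ e.2), mul_one, hS.norm_apply]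
  rw [← h.tsum_eigenDim hB hM, ← habs] at htop
  change traceNorm D T ≠ ⊤ at htop
  refine ⟨htop, ⋃ s, B s, fun e => T e, fun e => e, ⟨?_, fun x => ?_⟩, ?_⟩
  · rw [hnorm] at htop
    refine (ENNReal.summable_toReal htop).congr fun e => ENNReal.toReal_ofReal (by positivity)
  · exact ((hM.hasSum_component R x).map T T.continuous).congr_fun fun e =>
      (map_mulRight R T _ _).symm
  · rw [hnorm, ENNReal.tsum_toReal_eq fun e => ENNReal.ofReal_ne_top]
    exact tsum_congr fun e => (ENNReal.toReal_ofReal (by positivity)).symm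

end TraceClass

/-! ### Properties of the `N`-trace -/

namespace TraceClass

open HilbertScalars ScalarInnerSpace ScalarHilbertSpace

variable {D : Type*} {R : Type*} {H : Type*} [NormedRing D] [NormedAlgebra ℝ D] [StarRing D]
  [HilbertScalars D] [Ring R] [Algebra ℝ R] [NormedAddCommGroup H] [InnerProductSpace ℝ H]
  [Module R H] [Inner D H] [Star (H →L[R] H)] [ScalarHilbertSpace D R H]
  {A B T : H →L[R] H} {N N' : Set H}

/-- A self-conjugate scalar is real, since `(q - ‖q‖) (q + ‖q‖) = q* q - ‖q‖² = 0`. -/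
theorem _root_.HilbertScalars.exists_eq_algebraMap {q : D} (hq : star q = q) :
    ∃ r : ℝ, q = algebraMap ℝ D r := by
  have h := star_mul_self q
  rw [hq, sq, map_mul] at h
  have h0 : (q - algebraMap ℝ D ‖q‖) * (q + algebraMap ℝ D ‖q‖) = 0 := by
    rw [sub_mul, mul_add, mul_add, h, Algebra.commutes ‖q‖ q]
    abel
  have h1 := congrArg norm h0
  rw [norm_mul, norm_zero, mul_eq_zero, norm_eq_zero, norm_eq_zero] at h1
  rcases h1 with h1 | h1
  · exact ⟨‖q‖, sub_eq_zero.1 h1⟩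
  · exact ⟨-‖q‖, by rw [map_neg]; exact eq_neg_of_add_eq_zero_left h1⟩

theorem inner_apply_self_star (x : H) : inner D x (star A x) = star (inner D x (A x)) := by
  rw [inner_star_right, star_inner]

theorem traceOn_star (A : H →L[R] H) : traceOn D N (star A) = star (traceOn D N A) := by
  rw [traceOn, traceOn, tsum_star]
  exact tsum_congr fun u => inner_apply_self_star _

theorem exists_traceOn_eq_algebraMap (h : ∀ u ∈ N, star (inner D u (T u)) = inner D u (T u)) :
    ∃ r : ℝ, traceOn D N T = algebraMap ℝ D r := by
  refine exists_eq_algebraMap ?_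
  rw [traceOn, tsum_star]
  exact tsum_congr fun u => h u u.2

theorem re_traceOn (h : HasSum (fun u : N => inner D (u : H) (T u)) (traceOn D N T)) :
    HasSum (fun u : N => re (inner D (u : H) (T u))) (re (traceOn D N T)) :=
  h.map (re : D →ₗ[ℝ] ℝ) continuous_re

theorem isNonnegReal_traceOn (h : HasSum (fun u : N => inner D (u : H) (T u)) (traceOn D N T))
    (hT : IsPositive D T) : IsNonnegReal D (traceOn D N T) := by
  obtain ⟨r, hr⟩ := exists_traceOn_eq_algebraMap (D := D) (N := N) (T := T) fun u _ => by
    obtain ⟨r, -, hr⟩ := hT u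
    rw [hr, star_algebraMap_real]
  refine ⟨r, ?_, hr⟩
  rw [← re_algebraMap (D := D) r, ← hr]
  refine (re_traceOn h).nonneg fun u => ?_
  obtain ⟨s, hs, hsu⟩ := hT u
  rw [hsu, re_algebraMap]
  exact hs

theorem re_traceOn_mono (hA : HasSum (fun u : N => inner D (u : H) (A u)) (traceOn D N A))
    (hB : HasSum (fun u : N => inner D (u : H) (B u)) (traceOn D N B))
    (h : IsPositive D (A - B)) : re (traceOn D N B) ≤ re (traceOn D N A) := by
  refine hasSum_le (fun u => ?_) (re_traceOn hB) (re_traceOn hA)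
  obtain ⟨s, hs, hsu⟩ := h u
  rw [sub_apply, ScalarInnerSpace.inner_sub_right] at hsu
  have := congrArg (re : D → ℝ) hsu
  rw [re_algebraMap, map_sub] at this
  linarith

theorem traceOn_eq_add {C : H →L[R] H}
    (hA : HasSum (fun u : N => inner D (u : H) (A u)) (traceOn D N A))
    (hB : HasSum (fun u : N => inner D (u : H) (B u)) (traceOn D N B)) (p q : D)
    (h : ∀ u : H, inner D u (C u) = p * inner D u (A u) + q * inner D u (B u)) :
    traceOn D N C = p * traceOn D N A + q * traceOn D N B := by
  rw [← ((hA.mul_left p).add (hB.mul_left q)).tsum_eq]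
  exact tsum_congr fun u => h u

variable [IsScalarTower ℝ R H]

/-- A self-adjoint operator acts on a unit eigenvector by a real scalar. -/
theorem IsEigenvector.exists_real (hA : star A = A) {u : H} (hu : IsEigenvector A u)
    (h1 : inner D u u = 1) : ∃ r : ℝ, A u = r • u := by
  obtain ⟨-, q, hq⟩ := hu
  obtain ⟨p, rfl⟩ := (toScalar H : D ≃ₗ[ℝ] R).surjective q
  change A u = mulRight R u p at hq
  have hp : inner D u (A u) = p := by rw [hq, inner_mulRight_right, h1, one_mul]
  obtain ⟨r, rfl⟩ := exists_eq_algebraMap (q := p) (by rw [← hp, ← inner_apply_self_star, hA])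
  exact ⟨r, by rw [hq, mulRight_algebraMap]⟩

theorem inner_mul_of_apply_eq_smul (hA : star A = A) {r : ℝ} {u : H} (hu : A u = r • u) :
    inner D u ((A * B) u) = r • inner D u (B u) ∧ inner D u ((B * A) u) = r • inner D u (B u) := by
  constructor
  · rw [mul_apply_eq_comp, ← inner_star_left, hA, hu, inner_real_smul_left R]
  · rw [mul_apply_eq_comp, hu, ← inner_real_smul_right R]
    exact congrArg _ ((B.restrictScalars ℝ).map_smul r u)

variable (D) in
/-- In a Hilbert basis of eigenvectors of `A = A*`, the traces of `BA` and `AB` agree term by term: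
both terms are `r ⟨u|Bu⟩`, where `r` is the real eigenvalue. -/
theorem traceOn_union_eigenbasis (hA : star A = A) {N₀ N₁ : Set H} {V : Set H}
    (hN₀ : N₀ ⊆ kernel A) (hN₁ : IsHilbertBasisOf D V N₁) (he : ∀ u ∈ N₁, IsEigenvector A u)
    (B : H →L[R] H) :
    traceOn D (N₀ ∪ N₁) (B * A) = traceOn D (N₀ ∪ N₁) (A * B) ∧
      (star B = B → ∃ r : ℝ, traceOn D (N₀ ∪ N₁) (A * B) = algebraMap ℝ D r) := by
  have key : ∀ u ∈ N₀ ∪ N₁, ∃ r : ℝ, A u = r • u := by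
    rintro u (hu | hu)
    · exact ⟨0, by rw [zero_smul]; exact hN₀ hu⟩
    · exact (he u hu).exists_real hA (hN₁.inner_self u hu)
  refine ⟨tsum_congr fun u => ?_, fun hB => exists_traceOn_eq_algebraMap fun u hu => ?_⟩
  · obtain ⟨r, hr⟩ := key u u.2
    rw [(inner_mul_of_apply_eq_smul hA hr).1, (inner_mul_of_apply_eq_smul hA hr).2]
  · obtain ⟨r, hr⟩ := key u hu
    rw [(inner_mul_of_apply_eq_smul hA hr).1, Algebra.smul_def, star_mul, star_algebraMap_real,
      ← inner_apply_self_star, hB, Algebra.commutes]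

variable [CompleteSpace H]

section

variable [StrongRankCondition R]

theorem IsTraceClass.summable_norm (hT : IsTraceClass D T) (hN : IsHilbertBasis D N) :
    Summable fun u : N => ‖(inner D (u : H) (T u) : D)‖ :=
  let ⟨_, _, _, _, h, _⟩ := hT.exists_hasNuclearSeries
  h.summable_norm hN

theorem IsTraceClass.hasSum_traceOn (hT : IsTraceClass D T) (hN : IsHilbertBasis D N) :
    HasSum (fun u : N => inner D (u : H) (T u)) (traceOn D N T) :=
  let ⟨_, _, _, _, h, _⟩ := hT.exists_hasNuclearSeries
  h.hasSum_traceOn hN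

theorem IsTraceClass.norm_traceOn_le (hT : IsTraceClass D T) (hN : IsHilbertBasis D N) :
    ‖traceOn D N T‖ ≤ (traceNorm D T).toReal :=
  let ⟨_, _, _, _, h, hs⟩ := hT.exists_hasNuclearSeries
  hs ▸ h.norm_traceOn_le hN

theorem IsTraceClass.countable_ne_zero (hT : IsTraceClass D T) (hN : IsHilbertBasis D N) :
    {x ∈ N | (inner D x (T x) : D) ≠ 0}.Countable := by
  refine ((hT.hasSum_traceOn hN).summable.countable_support.image (Subtype.val : N → H)).mono ?_
  rintro x ⟨hx, h⟩
  exact ⟨⟨x, hx⟩, h, rfl⟩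

theorem IsTraceClass.tendsto_sum_range (hT : IsTraceClass D T) (hN : IsHilbertBasis D N)
    (e : ℕ ≃ {x : H // x ∈ N ∧ (inner D x (T x) : D) ≠ 0}) :
    Tendsto (fun n => ∑ k ∈ Finset.range n, inner D (e k : H) (T (e k))) atTop
      (𝓝 (traceOn D N T)) := by
  let g : {x : H // x ∈ N ∧ (inner D x (T x) : D) ≠ 0} → N := fun x => ⟨x, x.2.1⟩
  have hg : Function.Injective g := fun x y h => Subtype.ext (congrArg (Subtype.val : N → H) h)
  have h := hT.hasSum_traceOn hN
  rw [← hg.hasSum_iff, ← e.hasSum_iff] at h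
  · exact h.tendsto_sum_nat
  · intro u hu
    by_contra hne
    exact hu ⟨⟨u, u.2, hne⟩, rfl⟩

/-- A tracial functional of the `N`-trace of a trace class operator does not depend on `N`. -/
theorem IsTraceClass.map_traceOn_eq (hA : IsTraceClass D A) (hN : IsHilbertBasis D N)
    (hN' : IsHilbertBasis D N') {E : Type*} [NormedAddCommGroup E] [NormedSpace ℝ E]
    (φ : D →ₗ[ℝ] E) (hφ : ∀ p q, φ (p * q) = φ (q * p)) :
    φ (traceOn D N A) = φ (traceOn D N' A) := by
  obtain ⟨-, _, _, _, h, -⟩ := hA.exists_hasNuclearSeries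
  rw [h.map_traceOn hN φ hφ, h.map_traceOn hN' φ hφ]

theorem IsTraceClass.map_traceOn_mul_comm (hA : IsTraceClass D A) (B : H →L[R] H)
    (hN : IsHilbertBasis D N) {E : Type*} [NormedAddCommGroup E] [NormedSpace ℝ E]
    (φ : D →ₗ[ℝ] E) (hφ : ∀ p q, φ (p * q) = φ (q * p)) :
    φ (traceOn D N (A * B)) = φ (traceOn D N (B * A)) := by
  obtain ⟨-, _, _, _, h, -⟩ := hA.exists_hasNuclearSeries
  rw [(h.mul_right B).map_traceOn hN φ hφ, (h.mul_left B).map_traceOn hN φ hφ]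
  simp only [inner_star_left]

theorem IsTraceClass.re_traceOn_eq (hA : IsTraceClass D A) (hN : IsHilbertBasis D N)
    (hN' : IsHilbertBasis D N') : re (traceOn D N A) = re (traceOn D N' A) :=
  hA.map_traceOn_eq hN hN' re re_mul_comm

theorem IsTraceClass.summable_norm_mul (hA : IsTraceClass D A) (B : H →L[R] H)
    (hN : IsHilbertBasis D N) :
    Summable (fun u : N => ‖(inner D (u : H) ((A * B) u) : D)‖) ∧
      Summable (fun u : N => ‖(inner D (u : H) ((B * A) u) : D)‖) ∧
      re (traceOn D N (A * B)) = re (traceOn D N (B * A)) :=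
  let ⟨_, _, _, _, h, _⟩ := hA.exists_hasNuclearSeries
  ⟨(h.mul_right B).summable_norm hN, (h.mul_left B).summable_norm hN,
    hA.map_traceOn_mul_comm B hN re re_mul_comm⟩

theorem IsTraceClass.traceOn_eq_of_star_eq (hA : IsTraceClass D A) (h : star A = A)
    (hN : IsHilbertBasis D N) (hN' : IsHilbertBasis D N') :
    traceOn D N A = traceOn D N' A := by
  have hreal : ∀ M : Set H, ∃ r : ℝ, traceOn D M A = algebraMap ℝ D r := fun M =>
    exists_traceOn_eq_algebraMap fun u _ => by rw [← inner_apply_self_star, h]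
  obtain ⟨r, hr⟩ := hreal N
  obtain ⟨r', hr'⟩ := hreal N'
  have := hA.re_traceOn_eq hN hN'
  rw [hr, hr', re_algebraMap, re_algebraMap] at this
  rw [hr, hr', this]

end

variable (R) in
/-- Multiplying the vectors of a Hilbert basis by unit scalars gives a Hilbert basis. -/
theorem IsHilbertBasis.image_mulRight (hN : IsHilbertBasis D N) {c : H → D}
    (hc : ∀ u, ‖c u‖ = 1) :
    IsHilbertBasis D ((fun u => mulRight R u (c u)) '' N) ∧
      Set.InjOn (fun u => mulRight R u (c u)) N := by
  have hself : ∀ u ∈ N, inner D (mulRight R u (c u)) (mulRight R u (c u)) = 1 := fun u hu => by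
    rw [inner_mulRight_right, inner_mulRight_left, hN.inner_self u hu, mul_one,
      HilbertScalars.star_mul_self, hc]
    simp
  have hne : ∀ u ∈ N, ∀ v ∈ N, u ≠ v →
      inner D (mulRight R u (c u)) (mulRight R v (c v)) = 0 := fun u hu v hv huv => by
    rw [inner_mulRight_right, inner_mulRight_left, hN.inner_ne u hu v hv huv, mul_zero, zero_mul]
  refine ⟨⟨Set.subset_univ _, ?_, ?_, ?_⟩, ?_⟩
  · rintro _ ⟨u, hu, rfl⟩
    exact hself u hu
  · rintro _ ⟨u, hu, rfl⟩ _ ⟨v, hv, rfl⟩ huv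
    exact hne u hu v hv fun h => huv (by rw [h])
  · intro x _ hx
    refine hN.total x trivial fun u hu => ?_
    have h := hx _ ⟨u, hu, rfl⟩
    rw [inner_mulRight_left] at h
    have h' := congrArg norm h
    rw [norm_mul, norm_star, hc, one_mul, norm_zero] at h'
    exact norm_eq_zero.1 h'
  · intro u hu v hv huv
    by_contra h
    have h0 := hne u hu v hv h
    rw [← show mulRight R u (c u) = mulRight R v (c v) from huv, hself u hu] at h0
    have := congrArg (re : D → ℝ) h0
    rw [map_zero, re_one] at this
    exact one_ne_zero this

/-- If the `N`-trace of `A` does not depend on `N`, replacing a single basis vector `u` by `u q`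
shows that `⟨u|Au⟩` is invariant under conjugation by unit scalars. -/
theorem IsTraceClass.conj_inner_eq [StrongRankCondition R] (hA : IsTraceClass D A)
    (h : ∀ N N' : Set H, IsHilbertBasis D N → IsHilbertBasis D N' →
      traceOn D N A = traceOn D N' A) {u : H} (hu : inner D u u = 1) {q : D} (hq : ‖q‖ = 1) :
    star q * inner D u (A u) * q = inner D u (A u) := by
  classical
  obtain ⟨N, huN, hN⟩ := exists_isHilbertBasisOf_superset (D := D) R (V := ⊤) (M := {u})
    ⟨by rintro _ rfl; exact hu, by rintro _ rfl _ rfl h; exact absurd rfl h⟩ (Set.subset_univ _)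
  replace hN : IsHilbertBasis D N := hN
  let c : H → D := fun v => if v = u then q else 1
  obtain ⟨hN', hinj⟩ := hN.image_mulRight R (c := c) fun v => by
    by_cases hv : v = u <;> simp [c, hv, hq]
  have h1 := hA.hasSum_traceOn hN
  have h2 := hA.hasSum_traceOn hN'
  rw [← h N _ hN hN', ← (Equiv.Set.imageOfInjOn _ N hinj).hasSum_iff] at h2
  have h3 := h2.sub h1
  rw [sub_self] at h3
  have h4 := h3.unique (hasSum_single ⟨u, huN rfl⟩ ?_)
  · rw [← sub_eq_zero, h4]
    simp [Equiv.Set.imageOfInjOn, c, map_mulRight, inner_mulRight_right, inner_mulRight_left]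
  · rintro ⟨v, hv⟩ hvu
    have hvu' : v ≠ u := fun e => hvu (Subtype.ext e)
    simp [Equiv.Set.imageOfInjOn, c, hvu', mulRight_one]

end TraceClass

/-! ### The real, complex and quaternionic cases -/

section

open HilbertScalars ScalarInnerSpace ScalarHilbertSpace

instance RCLike.instHilbertScalars (𝕜 : Type*) [RCLike 𝕜] : HilbertScalars 𝕜 where
  finiteDimensional := inferInstance
  re := RCLike.reLm
  re_algebraMap r := RCLike.ofReal_re r
  re_mul_comm p q := by rw [mul_comm]
  star_mul_self q := by
    rw [RCLike.star_def, RCLike.conj_mul, RCLike.algebraMap_eq_ofReal, RCLike.ofReal_pow]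

theorem RCLike.isScalarTower_rclikeToReal (𝕜 H : Type*) [RCLike 𝕜] [NormedAddCommGroup H]
    [InnerProductSpace 𝕜 H] :
    letI := InnerProductSpace.rclikeToReal 𝕜 H
    IsScalarTower ℝ 𝕜 H :=
  letI := InnerProductSpace.rclikeToReal 𝕜 H
  ⟨fun r q x => by
    rw [Algebra.smul_def, mul_smul]
    rfl⟩

/-- A real or complex Hilbert space, with its underlying real Hilbert space. -/
abbrev RCLike.scalarHilbertSpace (𝕜 H : Type*) [RCLike 𝕜] [NormedAddCommGroup H]
    [InnerProductSpace 𝕜 H] [CompleteSpace H] :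
    letI := InnerProductSpace.rclikeToReal 𝕜 H
    ScalarHilbertSpace 𝕜 𝕜 H :=
  letI := InnerProductSpace.rclikeToReal 𝕜 H
  { inner_add_right := fun x y z => _root_.inner_add_right x y z
    star_inner := fun x y => inner_conj_symm x y
    inner_self := fun x => by
      rw [inner_self_eq_norm_sq_to_K, RCLike.algebraMap_eq_ofReal, RCLike.ofReal_pow]
    re_inner := fun x y => rfl
    toScalar := LinearEquiv.refl ℝ 𝕜
    inner_smul_right := fun x y q => by
      rw [LinearEquiv.refl_apply, _root_.inner_smul_right, mul_comm]
    inner_star_left := fun A x y => ContinuousLinearMap.adjoint_inner_left A y x }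

instance Quaternion.instHilbertScalars : HilbertScalars ℍ[ℝ] where
  finiteDimensional := inferInstance
  re :=
    { toFun := fun q => q.re
      map_add' := fun p q => by simp
      map_smul' := fun r q => by simp }
  re_algebraMap r := Quaternion.re_coe r
  re_mul_comm := QuaternionicInnerProductSpace.re_mul_comm
  star_mul_self q := by
    rw [Quaternion.star_mul_self, Quaternion.normSq_eq_norm_mul_self, sq]
    rfl

instance QuaternionicInnerProductSpace.instScalarHilbertSpace (H : Type*) [NormedAddCommGroup H]
    [QuaternionicInnerProductSpace H] [CompleteSpace H] :
    ScalarHilbertSpace ℍ[ℝ] ℍ[ℝ]ᵐᵒᵖ H where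
  inner_add_right := QuaternionicInnerProductSpace.inner_add_right
  star_inner x y := QuaternionicInnerProductSpace.conj_inner_symm x y
  inner_self := QuaternionicInnerProductSpace.inner_self_eq
  re_inner _ _ := rfl
  toScalar := MulOpposite.opLinearEquiv ℝ
  inner_smul_right := QuaternionicInnerProductSpace.inner_smul_right
  inner_star_left := QuaternionicInnerProductSpace.adjoint_inner_left

namespace Quaternion

/-- A quaternion commuting with the imaginary units is real, so equal to its conjugate. -/
theorem star_eq_of_conj_eq {a : ℍ[ℝ]} (h : ∀ q : ℍ[ℝ], ‖q‖ = 1 → star q * a * q = a) :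
    star a = a := by
  have hn : ∀ q : ℍ[ℝ], q.re ^ 2 + q.imI ^ 2 + q.imJ ^ 2 + q.imK ^ 2 = 1 → ‖q‖ = 1 :=
    fun q hq => by
      rw [← normSq_def', normSq_eq_norm_mul_self] at hq
      nlinarith [norm_nonneg q]
  obtain ⟨i, i₀, i₁, i₂, i₃⟩ : ∃ q : ℍ[ℝ], q.re = 0 ∧ q.imI = 1 ∧ q.imJ = 0 ∧ q.imK = 0 :=
    ⟨⟨0, 1, 0, 0⟩, rfl, rfl, rfl, rfl⟩
  obtain ⟨j, j₀, j₁, j₂, j₃⟩ : ∃ q : ℍ[ℝ], q.re = 0 ∧ q.imI = 0 ∧ q.imJ = 1 ∧ q.imK = 0 :=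
    ⟨⟨0, 0, 1, 0⟩, rfl, rfl, rfl, rfl⟩
  have hi := Quaternion.ext_iff.1 (h i (hn i (by simp [i₀, i₁, i₂, i₃])))
  have hj := Quaternion.ext_iff.1 (h j (hn j (by simp [j₀, j₁, j₂, j₃])))
  simp only [re_mul, imI_mul, imJ_mul, imK_mul, re_star, imI_star, imJ_star, imK_star,
    i₀, i₁, i₂, i₃, j₀, j₁, j₂, j₃] at hi hj
  ext <;> simp only [re_star, imI_star, imJ_star, imK_star] <;> linarith

theorem eq_zero_of_mul_eq_star_mul {a : ℍ[ℝ]} (h : ∀ q : ℍ[ℝ], a * q = star q * a) : a = 0 := by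
  obtain ⟨i, i₀, i₁, i₂, i₃⟩ : ∃ q : ℍ[ℝ], q.re = 0 ∧ q.imI = 1 ∧ q.imJ = 0 ∧ q.imK = 0 :=
    ⟨⟨0, 1, 0, 0⟩, rfl, rfl, rfl, rfl⟩
  obtain ⟨j, j₀, j₁, j₂, j₃⟩ : ∃ q : ℍ[ℝ], q.re = 0 ∧ q.imI = 0 ∧ q.imJ = 1 ∧ q.imK = 0 :=
    ⟨⟨0, 0, 1, 0⟩, rfl, rfl, rfl, rfl⟩
  have hi := Quaternion.ext_iff.1 (h i)
  have hj := Quaternion.ext_iff.1 (h j)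
  have hk := Quaternion.ext_iff.1 (h (i * j))
  simp only [re_mul, imI_mul, imJ_mul, imK_mul, re_star, imI_star, imJ_star, imK_star,
    i₀, i₁, i₂, i₃, j₀, j₁, j₂, j₃] at hi hj hk
  ext <;> simp only [re_zero, imI_zero, imJ_zero, imK_zero] <;> linarith

end Quaternion

namespace QuaternionicInnerProductSpace

variable {H : Type*} [NormedAddCommGroup H] [QuaternionicInnerProductSpace H] [CompleteSpace H]

/-- Polarization: an operator with real `⟨u|Au⟩` for all `u` is self-adjoint. -/
theorem star_eq_of_forall_inner_real {A : H →L[ℍ[ℝ]ᵐᵒᵖ] H}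
    (h : ∀ u : H, star (inner ℍ[ℝ] u (A u)) = inner ℍ[ℝ] u (A u)) : star A = A := by
  -- the sesquilinear form of `A - A*` vanishes on the diagonal
  let c : H → H → ℍ[ℝ] := fun x y => inner ℍ[ℝ] x (A y) - inner ℍ[ℝ] (A x) y
  have hc : ∀ x, c x x = 0 := fun x => by
    simp only [c]
    rw [← conj_inner_symm (A x) x, h, sub_self]
  have hanti : ∀ x y, c x y = -c y x := fun x y => by
    have h1 : c (x + y) (x + y) = c x x + c x y + c y x + c y y := by
      simp only [c, map_add, QuaternionicInnerProductSpace.inner_add_right,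
        QuaternionicInnerProductSpace.inner_add_left]
      abel
    rw [hc, hc, hc, zero_add, add_zero] at h1
    exact eq_neg_of_add_eq_zero_left h1.symm
  have hright : ∀ x y q, c x (MulOpposite.op q • y) = c x y * q := fun x y q => by
    simp only [c, map_smul, QuaternionicInnerProductSpace.inner_smul_right, sub_mul]
  have hleft : ∀ x y q, c (MulOpposite.op q • x) y = star q * c x y := fun x y q => by
    simp only [c, map_smul, QuaternionicInnerProductSpace.inner_smul_left, mul_sub]
  have hzero : ∀ x y, c x y = 0 := fun x y => Quaternion.eq_zero_of_mul_eq_star_mul fun q => by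
    rw [← hright, hanti, hleft, hanti y x, mul_neg, neg_neg]
  ext x
  refine ScalarInnerSpace.ext_inner ℍ[ℝ] fun z => ?_
  rw [inner_star_right]
  exact (sub_eq_zero.1 (hzero z x)).symm

/-- Over `ℍ`, the `N`-trace of `A` does not depend on `N` only if `A` is self-adjoint. -/
theorem star_eq_of_traceOn_eq {A : H →L[ℍ[ℝ]ᵐᵒᵖ] H} (hA : IsTraceClass ℍ[ℝ] A)
    (h : ∀ N N' : Set H, IsHilbertBasis ℍ[ℝ] N → IsHilbertBasis ℍ[ℝ] N' →
      traceOn ℍ[ℝ] N A = traceOn ℍ[ℝ] N' A) : star A = A := by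
  refine star_eq_of_forall_inner_real fun u => ?_
  rcases eq_or_ne u 0 with rfl | hu
  · simp [ScalarInnerSpace.inner_zero_right]
  obtain ⟨r, v, rfl, hv⟩ : ∃ (r : ℝ) (v : H), u = r • v ∧ inner ℍ[ℝ] v v = 1 := by
    have hn : ‖u‖ ≠ 0 := norm_ne_zero_iff.2 hu
    refine ⟨‖u‖, ‖u‖⁻¹ • u, (smul_inv_smul₀ hn u).symm, ?_⟩
    rw [inner_self_eq, norm_smul, norm_inv, norm_norm, inv_mul_cancel₀ hn]
    simp
  have hAv : A (r • v) = r • A v := (A.restrictScalars ℝ).map_smul r v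
  rw [hAv, inner_real_smul_right ℍ[ℝ]ᵐᵒᵖ, inner_real_smul_left ℍ[ℝ]ᵐᵒᵖ, Quaternion.star_smul,
    Quaternion.star_smul, Quaternion.star_eq_of_conj_eq fun q hq => hA.conj_inner_eq h hv hq]

end QuaternionicInnerProductSpace

end

end

theorem proposition2p2 :
  -- real and complex Hilbert spaces
  (∀ (𝕜 : Type*) [RCLike 𝕜] (H : Type*) [NormedAddCommGroup H] [InnerProductSpace 𝕜 H]
      [CompleteSpace H],
    -- the `N`-trace is well defined
    (∀ T : H →L[𝕜] H, IsTraceClass 𝕜 T → ∀ N : Set H, IsHilbertBasis 𝕜 N →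
      {x ∈ N | inner 𝕜 x (T x) ≠ 0}.Countable ∧
      Summable (fun x : N => ‖inner 𝕜 (x : H) (T x)‖) ∧
      HasSum (fun x : N => inner 𝕜 (x : H) (T x)) (traceOn 𝕜 N T) ∧
      (∀ e : ℕ ≃ {x : H // x ∈ N ∧ inner 𝕜 x (T x) ≠ 0},
        Tendsto (fun n => ∑ k ∈ Finset.range n, inner 𝕜 (e k : H) (T (e k))) atTop
          (𝓝 (traceOn 𝕜 N T))) ∧
      traceNorm 𝕜 T ≠ ⊤ ∧
      ‖traceOn 𝕜 N T‖ ≤ (traceNorm 𝕜 T).toReal) ∧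
    -- compatibility with adjoints, linearity, positivity
    (∀ N : Set H, IsHilbertBasis 𝕜 N → ∀ A B : H →L[𝕜] H,
      IsTraceClass 𝕜 A → IsTraceClass 𝕜 B →
      traceOn 𝕜 N (star A) = star (traceOn 𝕜 N A) ∧
      (∀ a b : 𝕜, traceOn 𝕜 N (a • A + b • B) =
        a • traceOn 𝕜 N A + b • traceOn 𝕜 N B) ∧
      (IsPositive 𝕜 A → IsNonnegReal 𝕜 (traceOn 𝕜 N A))) ∧
    -- basis independence and cyclicity
    (∀ A : H →L[𝕜] H, IsTraceClass 𝕜 A →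
      (∀ N N' : Set H, IsHilbertBasis 𝕜 N → IsHilbertBasis 𝕜 N' →
        traceOn 𝕜 N A = traceOn 𝕜 N' A) ∧
      (∀ (B : H →L[𝕜] H) (N : Set H), IsHilbertBasis 𝕜 N →
        traceOn 𝕜 N (A * B) = traceOn 𝕜 N (B * A))) ∧
    -- the real part is basis independent and cyclic
    (∀ A : H →L[𝕜] H, IsTraceClass 𝕜 A →
      (∀ N N' : Set H, IsHilbertBasis 𝕜 N → IsHilbertBasis 𝕜 N' →
        RCLike.re (traceOn 𝕜 N A) = RCLike.re (traceOn 𝕜 N' A)) ∧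
      (∀ (B : H →L[𝕜] H) (N : Set H), IsHilbertBasis 𝕜 N →
        Summable (fun x : N => ‖inner 𝕜 (x : H) ((A * B) x)‖) ∧
        Summable (fun x : N => ‖inner 𝕜 (x : H) ((B * A) x)‖) ∧
        RCLike.re (traceOn 𝕜 N (A * B)) = RCLike.re (traceOn 𝕜 N (B * A)))) ∧
    -- traces computed in a Hilbert basis of eigenvectors
    (∀ A : H →L[𝕜] H, IsTraceClass 𝕜 A → star A = A → ∀ N₀ N₁ : Set H,
      IsHilbertBasisOf 𝕜 (kernel A) N₀ →
      IsHilbertBasisOf 𝕜 (perp 𝕜 (kernel A)) N₁ → (∀ u ∈ N₁, IsEigenvector A u) →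
      ∀ B : H →L[𝕜] H, IsTraceClass 𝕜 B →
        traceOn 𝕜 (N₀ ∪ N₁) (B * A) = traceOn 𝕜 (N₀ ∪ N₁) (A * B) ∧
        (star B = B → ∃ r : ℝ, traceOn 𝕜 (N₀ ∪ N₁) (A * B) = algebraMap ℝ 𝕜 r)) ∧
    -- monotonicity
    (∀ A B : H →L[𝕜] H, IsTraceClass 𝕜 A → IsTraceClass 𝕜 B → IsPositive 𝕜 (A - B) →
      ∀ N : Set H, IsHilbertBasis 𝕜 N →
        RCLike.re (traceOn 𝕜 N B) ≤ RCLike.re (traceOn 𝕜 N A))) ∧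
  -- quaternionic Hilbert spaces
  (∀ (H : Type*) [NormedAddCommGroup H] [QuaternionicInnerProductSpace H] [CompleteSpace H],
    -- the `N`-trace is well defined
    (∀ T : H →L[ℍ[ℝ]ᵐᵒᵖ] H, IsTraceClass ℍ[ℝ] T → ∀ N : Set H, IsHilbertBasis ℍ[ℝ] N →
      {x ∈ N | inner ℍ[ℝ] x (T x) ≠ 0}.Countable ∧
      Summable (fun x : N => ‖inner ℍ[ℝ] (x : H) (T x)‖) ∧
      HasSum (fun x : N => inner ℍ[ℝ] (x : H) (T x)) (traceOn ℍ[ℝ] N T) ∧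
      (∀ e : ℕ ≃ {x : H // x ∈ N ∧ inner ℍ[ℝ] x (T x) ≠ 0},
        Tendsto (fun n => ∑ k ∈ Finset.range n, inner ℍ[ℝ] (e k : H) (T (e k))) atTop
          (𝓝 (traceOn ℍ[ℝ] N T))) ∧
      traceNorm ℍ[ℝ] T ≠ ⊤ ∧
      ‖traceOn ℍ[ℝ] N T‖ ≤ (traceNorm ℍ[ℝ] T).toReal) ∧
    -- compatibility with adjoints, linearity, positivity
    (∀ N : Set H, IsHilbertBasis ℍ[ℝ] N → ∀ A B : H →L[ℍ[ℝ]ᵐᵒᵖ] H,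
      IsTraceClass ℍ[ℝ] A → IsTraceClass ℍ[ℝ] B →
      traceOn ℍ[ℝ] N (star A) = star (traceOn ℍ[ℝ] N A) ∧
      (∀ a b : ℝ, traceOn ℍ[ℝ] N (a • A + b • B) =
        a • traceOn ℍ[ℝ] N A + b • traceOn ℍ[ℝ] N B) ∧
      (IsPositive ℍ[ℝ] A → IsNonnegReal ℍ[ℝ] (traceOn ℍ[ℝ] N A))) ∧
    -- basis independence characterizes self-adjointness
    (∀ A : H →L[ℍ[ℝ]ᵐᵒᵖ] H, IsTraceClass ℍ[ℝ] A →
      ((∀ N N' : Set H, IsHilbertBasis ℍ[ℝ] N → IsHilbertBasis ℍ[ℝ] N' →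
        traceOn ℍ[ℝ] N A = traceOn ℍ[ℝ] N' A) ↔ star A = A)) ∧
    -- the real part is basis independent and cyclic
    (∀ A : H →L[ℍ[ℝ]ᵐᵒᵖ] H, IsTraceClass ℍ[ℝ] A →
      (∀ N N' : Set H, IsHilbertBasis ℍ[ℝ] N → IsHilbertBasis ℍ[ℝ] N' →
        (traceOn ℍ[ℝ] N A).re = (traceOn ℍ[ℝ] N' A).re) ∧
      (∀ (B : H →L[ℍ[ℝ]ᵐᵒᵖ] H) (N : Set H), IsHilbertBasis ℍ[ℝ] N →
        Summable (fun x : N => ‖inner ℍ[ℝ] (x : H) ((A * B) x)‖) ∧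
        Summable (fun x : N => ‖inner ℍ[ℝ] (x : H) ((B * A) x)‖) ∧
        (traceOn ℍ[ℝ] N (A * B)).re = (traceOn ℍ[ℝ] N (B * A)).re)) ∧
    -- traces computed in a Hilbert basis of eigenvectors
    (∀ A : H →L[ℍ[ℝ]ᵐᵒᵖ] H, IsTraceClass ℍ[ℝ] A → star A = A → ∀ N₀ N₁ : Set H,
      IsHilbertBasisOf ℍ[ℝ] (kernel A) N₀ →
      IsHilbertBasisOf ℍ[ℝ] (perp ℍ[ℝ] (kernel A)) N₁ → (∀ u ∈ N₁, IsEigenvector A u) →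
      ∀ B : H →L[ℍ[ℝ]ᵐᵒᵖ] H, IsTraceClass ℍ[ℝ] B →
        traceOn ℍ[ℝ] (N₀ ∪ N₁) (B * A) = traceOn ℍ[ℝ] (N₀ ∪ N₁) (A * B) ∧
        (star B = B → ∃ r : ℝ, traceOn ℍ[ℝ] (N₀ ∪ N₁) (A * B) = algebraMap ℝ ℍ[ℝ] r)) ∧
    -- monotonicity
    (∀ A B : H →L[ℍ[ℝ]ᵐᵒᵖ] H, IsTraceClass ℍ[ℝ] A → IsTraceClass ℍ[ℝ] B →
      IsPositive ℍ[ℝ] (A - B) → ∀ N : Set H, IsHilbertBasis ℍ[ℝ] N →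
        (traceOn ℍ[ℝ] N B).re ≤ (traceOn ℍ[ℝ] N A).re)) := by
  refine ⟨?_, ?_⟩
  · intro 𝕜 _ H _ _ _
    let := InnerProductSpace.rclikeToReal 𝕜 H
    let := RCLike.scalarHilbertSpace 𝕜 H
    have := RCLike.isScalarTower_rclikeToReal 𝕜 H
    refine ⟨fun T hT N hN => ?_, fun N hN A B hA hB => ?_, fun A hA => ?_, fun A hA => ?_, ?_, ?_⟩
    · exact ⟨hT.countable_ne_zero hN, hT.summable_norm hN, hT.hasSum_traceOn hN,
        hT.tendsto_sum_range hN, hT.exists_hasNuclearSeries.1, hT.norm_traceOn_le hN⟩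
    · refine ⟨traceOn_star A, fun a b => ?_, isNonnegReal_traceOn (hA.hasSum_traceOn hN)⟩
      refine traceOn_eq_add (hA.hasSum_traceOn hN) (hB.hasSum_traceOn hN) a b fun u => ?_
      simp [_root_.inner_add_right, _root_.inner_smul_right]
    · exact ⟨fun N N' hN hN' => hA.map_traceOn_eq hN hN' LinearMap.id mul_comm,
        fun B N hN => hA.map_traceOn_mul_comm B hN LinearMap.id mul_comm⟩
    · exact ⟨fun N N' hN hN' => hA.re_traceOn_eq hN hN',
        fun B N hN => hA.summable_norm_mul B hN⟩
    · exact fun A _ hA' N₀ N₁ h₀ h₁ he B _ =>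
        traceOn_union_eigenbasis 𝕜 hA' h₀.subset h₁ he B
    · exact fun A B hA hB h N hN =>
        re_traceOn_mono (hA.hasSum_traceOn hN) (hB.hasSum_traceOn hN) h
  · intro H _ _ _
    refine ⟨fun T hT N hN => ?_, fun N hN A B hA hB => ?_, fun A hA => ?_, fun A hA => ?_, ?_, ?_⟩
    · exact ⟨hT.countable_ne_zero hN, hT.summable_norm hN, hT.hasSum_traceOn hN,
        hT.tendsto_sum_range hN, hT.exists_hasNuclearSeries.1, hT.norm_traceOn_le hN⟩
    · refine ⟨traceOn_star A, fun a b => ?_, isNonnegReal_traceOn (hA.hasSum_traceOn hN)⟩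
      rw [Algebra.smul_def, Algebra.smul_def]
      refine traceOn_eq_add (hA.hasSum_traceOn hN) (hB.hasSum_traceOn hN) _ _ fun u => ?_
      rw [← Algebra.smul_def, ← Algebra.smul_def,
        ← ScalarHilbertSpace.inner_real_smul_right ℍ[ℝ]ᵐᵒᵖ,
        ← ScalarHilbertSpace.inner_real_smul_right ℍ[ℝ]ᵐᵒᵖ, ← QuaternionicInnerProductSpace.inner_add_right]
      rfl
    · exact ⟨QuaternionicInnerProductSpace.star_eq_of_traceOn_eq hA,
        fun h N N' hN hN' => hA.traceOn_eq_of_star_eq h hN hN'⟩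
    · exact ⟨fun N N' hN hN' => hA.re_traceOn_eq hN hN',
        fun B N hN => hA.summable_norm_mul B hN⟩
    · exact fun A _ hA' N₀ N₁ h₀ h₁ he B _ =>
        traceOn_union_eigenbasis ℍ[ℝ] hA' h₀.subset h₁ he B
    · exact fun A B hA hB h N hN =>
        re_traceOn_mono (hA.hasSum_traceOn hN) (hB.hasSum_traceOn hN) h
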